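/- **Setting.** Let $n,T\ge 1$, $\eta\in[0,1)$ and $p(1),\dots,p(T)\in(0,1]$. The ground truth is $g^*=(g^*(1),\dots,g^*(T))$ with $g^*(k)\in\mathbb C^n$, $|g^*_i(k)|=1$ and $g_1^*(k)=1$ for all $i,k$, and $\sum_{k=1}^{T-1}\|g^*(k)-g^*(k+1)\|_2^2\le S_T$ for some $S_T\ge 0$. In the *Outliers model* one observes random Hermitian $n\times n$ matrices $A(1),\dots,A(T)$ with zero diagonal whose entries $A_{ij}(k)$ ($i<j$, $k\le T$) are jointly independent, $A_{ij}(k)$ being equal to $g_i^*(k)\overline{g_j^*(k)}$ with probability $(1-\eta)p(k)$, uniform on the unit circle with probability $\eta p(k)$, and $0$ with probability $1-p(k)$. Let $v_1,\dots,v_T$ be orthonormal eigenvectors of the Laplacian of the path graph on $T$ vertices, with eigenvalues $\lambda_1\ge\dots\ge\lambda_T=0$, let $\mathcal P_{\tau}=\big(\sum_{k=0}^{\tau-1}v_{T-k}v_{T-k}^\top\big)\otimes I_n$ and $\mathcal P_\tau^\perp=I_{nT}-\mathcal P_\tau$. Let $\overline G^*\in\mathbb C^{nT\times n}$ be the stacked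 matrix with blocks $g^*(k)g^*(k)^{H}-I_n$, let $D=(1-\eta)\,\mathrm{blkdiag}(p(1)I_n,\dots,p(T)I_n)$ and $\bar d=\frac1T\sum_k(1-\eta)p(k)$. Assume that $D$ is $\mu$-smooth for some $\mu\ge1$: $\|\mathcal P^\perp_{\tau}(D\overline G^*)\|_F^2\le\mu\bar d^2\|\mathcal P_\tau^\perp\overline G^*\|_F^2$ for all $\tau\in\{1,\dots,T\}$. Put $p_{\max}=\max_kp(k)$, $p_{\min}=\min_kp(k)$, $V=\max_kp(k)(1-p(k))$, $f=p_{\max}\eta+(1-\eta)^2V+p_{\max}V(1-\eta)$, $Q=\eta+Q(\eta)+\max_kQ(p(k))$, where $Q(q)$ is the subgaussian norm $\|X\|_{\psi_2}=\sup_{r\ge1}r^{-1/2}(\mathbb E|X|^r)^{1/r}$ of a centered Bernoulli($q$) variable $X$. For $\delta\in(0,1)$ let $\tilde f=f+Q^2\log(1/\delta)$, $\rho=\dfrac{\mu\bar d^2T^2S_T}{n\tilde f}$ and $\tau^*=\min\{1+\lfloor\rho^{1/3}\rfloor,T\}$ (with $\tau^*=T$ if $\tilde f=0$). **Estimator.**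 With $A$ the stacked observations, let $\hat G=\mathcal P_{\tau^*}A$ with blocks $\hat G(k)$, let $\hat g'(k)$ be an eigenvector for the largest eigenvalue of $\frac12(\hat G(k)+\hat G(k)^H)$, and let $\hat g_i(k)=\mathrm{ph}(\hat g'_i(k))\,e^{-\iota\hat\theta_1(k)}$, where $\mathrm{ph}(z)=z/|z|$ for $z\ne0$, $\mathrm{ph}(0)=1$, and $\hat\theta_1(k)$ is the argument of $\hat g_1'(k)$ (and $0$ if $\hat g'_1(k)=0$). Let $\hat g=(\hat g(1),\dots,\hat g(T))$. **Corollary.** There are absolute constants $C_1\in(0,1)$ and $C_2,C_3,C_4>0$ such that for every $\delta\in(0,C_1)$ the following holds, whatever the choice of the eigenvectors. 1. With probability at least $1-\delta$, $$\|\hat g-g^*\|_2^2\le\frac{C_2}{(1-\eta)^2p_{\min}^2}\Big(\max\Big\{\frac{\mu\bar d^2nT^2S_T}{1+\rho^{2/3}},\ \mu\bar d^2nS_T\Big\}\mathbf 1_{\tau^*<T}+\tilde f\,n^2\min\{1+\rho^{1/3},T\}\Big)$$ (if $\tilde f=0$, the right-hand side is read as $0$). 2. If moreover $S_T>0$ and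 $T\ge C_3\max\Big\{\Big(\dfrac{n\tilde f}{\mu\bar d^2S_T}\Big)^{1/2},\dfrac{\mu\bar d^2S_T}{n\tilde f}\Big\}$, then the right-hand side in 1 is at most $$C_4\,\frac{\tilde f^{2/3}}{(1-\eta)^2p_{\min}^2}\,(\mu\bar d^2)^{1/3}n^{5/3}T^{2/3}S_T^{1/3},$$ so that on the same event $\|\hat g-g^*\|_2^2$ is bounded by this quantity. 3. (Sparse, possibly disconnected graphs.) For all $\eta\in(0,1)$, $a,b>0$ and $m\ge1$ there are $K_1,K_2>0$, depending only on $\eta,a,b,m$, such that if $a/n\le p(k)\le b/n$ for all $k$, $\mu\le m$, $S_T>0$, $\delta\in(0,C_1)$ and $T\ge K_1\max\Big\{\Big(\dfrac{n^3\log(1/\delta)}{S_T}\Big)^{1/2},\dfrac{S_T}{n^3\log(1/\delta)}\Big\}$, then with probability at least $1-\delta$, $\|\hat g-g^*\|_2^2\le K_2\,n^3T^{2/3}S_T^{1/3}\log^{2/3}(1/\delta)$. -/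

import Mathlib

open MeasureTheory ProbabilityTheory
open scoped Matrix Kronecker

universe u

namespace DynSync

/-! ### The path graph and the low-frequency projection -/

/-- Incidence matrix of the directed path on `T` vertices: column `e` is the edge `e → e + 1`. -/
def incidence (T : ℕ) : Matrix (Fin T) (Fin (T - 1)) ℝ :=
  fun i e => if i.val = e.val then 1 else if i.val = e.val + 1 then -1 else 0

/-- Laplacian `M Mᵀ` of the path graph on `T` vertices. -/
def pathLaplacian (T : ℕ) : Matrix (Fin T) (Fin T) ℝ :=
  incidence T * (incidence T)ᵀ

/-- `v 0, …, v (T - 1)` is an orthonormal family of eigenvectors of the path Laplacian, listed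
in the order of decreasing eigenvalues. -/
structure IsPathEigenbasis {T : ℕ} (v : Fin T → Fin T → ℝ) : Prop where
  orthonormal : ∀ i j, v i ⬝ᵥ v j = if i = j then 1 else 0
  eigen : ∃ lam : Fin T → ℝ, Antitone lam ∧ ∀ j, pathLaplacian T *ᵥ v j = lam j • v j

/-- The `T × T` matrix `∑ v_j v_jᵀ` over the last `τ` indices `j`, that is, over the `τ`
smallest eigenvalues. -/
noncomputable def lowFreq {T : ℕ} (v : Fin T → Fin T → ℝ) (τ : ℕ) : Matrix (Fin T) (Fin T) ℝ :=
  ∑ j : Fin T with T ≤ j.val + τ, Matrix.vecMulVec (v j) (v j)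

/-- `𝒫_{τ,n} = (∑ v_j v_jᵀ) ⊗ I_n`. -/
noncomputable def proj {T : ℕ} (n : ℕ) (v : Fin T → Fin T → ℝ) (τ : ℕ) :
    Matrix (Fin T × Fin n) (Fin T × Fin n) ℂ :=
  ((lowFreq v τ).map (fun x : ℝ => (x : ℂ))) ⊗ₖ (1 : Matrix (Fin n) (Fin n) ℂ)

/-! ### Stacked matrices and norms -/

/-- `concat(X(1), …, X(T))`. -/
def stack {n T : ℕ} (X : Fin T → Matrix (Fin n) (Fin n) ℂ) :
    Matrix (Fin T × Fin n) (Fin n) ℂ :=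
  fun r j => X r.1 r.2 j

/-- The `k`-th `n × n` block of a stacked matrix. -/
def block {n T : ℕ} (X : Matrix (Fin T × Fin n) (Fin n) ℂ) (k : Fin T) :
    Matrix (Fin n) (Fin n) ℂ :=
  fun i j => X (k, i) j

/-- Squared Frobenius norm. -/
noncomputable def frobSq {ι κ : Type*} [Fintype ι] [Fintype κ] (X : Matrix ι κ ℂ) : ℝ :=
  ∑ i, ∑ j, ‖X i j‖ ^ 2

/-- Squared Euclidean distance of two stacked vectors in `ℂ^{nT}`. -/
noncomputable def distSq {n T : ℕ} (g h : Fin T → Fin n → ℂ) : ℝ :=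
  ∑ k, ∑ i, ‖g k i - h k i‖ ^ 2

/-! ### The ground truth -/

/-- The stacked matrix with blocks `g(k) g(k)ᴴ - I_n`. -/
noncomputable def gBar {n T : ℕ} (g : Fin T → Fin n → ℂ) :
    Matrix (Fin T × Fin n) (Fin n) ℂ :=
  stack fun k => Matrix.vecMulVec (g k) (star (g k)) - 1

/-- Quadratic variation `∑_{k=1}^{T-1} ‖g(k) - g(k+1)‖₂²`. -/
noncomputable def quadVar {n T : ℕ} (g : Fin T → Fin n → ℂ) : ℝ :=
  ∑ k : Fin (T - 1), ∑ i,
    ‖g ⟨k.val, by omega⟩ i - g ⟨k.val + 1, by omega⟩ i‖ ^ 2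

/-- Unit-modulus phases, anchored at the first item, with quadratic variation at most `S`. -/
structure IsGroundTruth {n T : ℕ} [NeZero n] (g : Fin T → Fin n → ℂ) (S : ℝ) : Prop where
  unit : ∀ k i, ‖g k i‖ = 1
  anchor : ∀ k, g k 0 = 1
  smooth : quadVar g ≤ S

/-! ### The Outliers model -/

/-- Uniform distribution on the unit circle: the law of `exp(ι φ)` for `φ` uniform on
`[0, 2π)`. -/
noncomputable def uniformCircle : Measure ℂ :=
  Measure.map (fun φ : ℝ => Complex.exp (φ * Complex.I))
    (ProbabilityTheory.cond volume (Set.Ico 0 (2 * Real.pi)))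

/-- Law of one off-diagonal observation: the true relative phase `z` with probability
`(1 - η) p`, a uniform phase with probability `η p`, and `0` with probability `1 - p`. -/
noncomputable def entryLaw (η p : ℝ) (z : ℂ) : Measure ℂ :=
  ENNReal.ofReal ((1 - η) * p) • Measure.dirac z
    + ENNReal.ofReal (η * p) • uniformCircle
    + ENNReal.ofReal (1 - p) • Measure.dirac 0

/-- The random matrices `A(1), …, A(T)` follow the Outliers model with ground truth `g`, outlier
level `η` and connection probabilities `p(1), …, p(T)`: they are Hermitian with zero diagonal,
and the entries above the diagonal, over all times, are independent with law `entryLaw`. -/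
structure IsOutliersModel {n T : ℕ} {Ω : Type*} [MeasurableSpace Ω] (P : Measure Ω)
    (η : ℝ) (p : Fin T → ℝ) (g : Fin T → Fin n → ℂ)
    (A : Ω → Fin T → Matrix (Fin n) (Fin n) ℂ) : Prop where
  measurable : ∀ k i j, Measurable fun ω => A ω k i j
  diag : ∀ ω k i, A ω k i i = 0
  hermitian : ∀ ω k, (A ω k).IsHermitian
  indep : iIndepFun
    (fun (e : {e : Fin T × Fin n × Fin n // e.2.1 < e.2.2}) (ω : Ω) =>
      A ω e.1.1 e.1.2.1 e.1.2.2) P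
  law : ∀ k i j, i < j →
    Measure.map (fun ω => A ω k i j) P = entryLaw η (p k) (g k i * star (g k j))

/-- `D = (1 - η) blkdiag(p(1) I_n, …, p(T) I_n)`. -/
noncomputable def dMat {T : ℕ} (n : ℕ) (η : ℝ) (p : Fin T → ℝ) :
    Matrix (Fin T × Fin n) (Fin T × Fin n) ℂ :=
  Matrix.diagonal fun r => (((1 - η) * p r.1 : ℝ) : ℂ)

/-- `d̄ = (1 / T) ∑ₖ (1 - η) p(k)`. -/
noncomputable def dBar {T : ℕ} (η : ℝ) (p : Fin T → ℝ) : ℝ :=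
  (∑ k, (1 - η) * p k) / T

/-- The matrix `D` is `μ`-smooth. -/
def IsDSmooth {n T : ℕ} (v : Fin T → Fin T → ℝ) (η : ℝ) (p : Fin T → ℝ)
    (g : Fin T → Fin n → ℂ) (μ : ℝ) : Prop :=
  ∀ τ : ℕ, 1 ≤ τ → τ ≤ T →
    frobSq ((1 - proj n v τ) * (dMat n η p * gBar g))
      ≤ μ * dBar η p ^ 2 * frobSq ((1 - proj n v τ) * gBar g)

/-! ### The noise parameters -/

/-- Subgaussian norm `sup_{q ≥ 1} q^{-1/2} (𝔼 |X|^q)^{1/q}`. -/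
noncomputable def psiTwoNorm {Ω : Type*} [MeasurableSpace Ω] (P : Measure Ω) (X : Ω → ℝ) : ℝ :=
  ⨆ q : Set.Ici (1 : ℝ), (q : ℝ) ^ (-(1 / 2) : ℝ) * (∫ ω, |X ω| ^ (q : ℝ) ∂P) ^ (1 / (q : ℝ))

/-- Bernoulli distribution with parameter `p`, as a measure on `ℝ`. -/
noncomputable def bernoulliLaw (p : ℝ) : Measure ℝ :=
  ENNReal.ofReal p • Measure.dirac 1 + ENNReal.ofReal (1 - p) • Measure.dirac 0

/-- `Q(p)`: subgaussian norm of a centered Bernoulli variable with parameter `p`. -/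
noncomputable def bernoulliNorm (p : ℝ) : ℝ :=
  psiTwoNorm (bernoulliLaw p) fun x => x - p

/-- `p_max`. -/
noncomputable def pMax {T : ℕ} (p : Fin T → ℝ) : ℝ := ⨆ k, p k

/-- `p_min`. -/
noncomputable def pMin {T : ℕ} (p : Fin T → ℝ) : ℝ := ⨅ k, p k

/-- `V = max_k p(k) (1 - p(k))`. -/
noncomputable def varMax {T : ℕ} (p : Fin T → ℝ) : ℝ := ⨆ k, p k * (1 - p k)

/-- `Q = η + Q(η) + max_k Q(p(k))`. -/
noncomputable def qNoise {T : ℕ} (η : ℝ) (p : Fin T → ℝ) : ℝ :=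
  η + bernoulliNorm η + ⨆ k, bernoulliNorm (p k)

/-- `f(η, p_max, V) = p_max η + (1 - η)² V + p_max V (1 - η)`. -/
noncomputable def fNoise {T : ℕ} (η : ℝ) (p : Fin T → ℝ) : ℝ :=
  pMax p * η + (1 - η) ^ 2 * varMax p + pMax p * varMax p * (1 - η)

/-- `f̃ = f + Q² log(1/δ)`. -/
noncomputable def fTilde {T : ℕ} (η : ℝ) (p : Fin T → ℝ) (δ : ℝ) : ℝ :=
  fNoise η p + qNoise η p ^ 2 * Real.log (1 / δ)

/-- `μ d̄² T² S / (n f̃)`. -/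
noncomputable def ratio {T : ℕ} (n : ℕ) (η : ℝ) (p : Fin T → ℝ) (μ S δ : ℝ) : ℝ :=
  μ * dBar η p ^ 2 * (T : ℝ) ^ 2 * S / (n * fTilde η p δ)

/-- `τ* = min {1 + ⌊(μ d̄² T² S / (n f̃))^{1/3}⌋, T}`; in the noiseless case `f̃ = 0` the
quotient is infinite and `τ* = T`. -/
noncomputable def tauStar {T : ℕ} (n : ℕ) (η : ℝ) (p : Fin T → ℝ) (μ S δ : ℝ) : ℕ :=
  if fTilde η p δ = 0 then T
  else min (1 + ⌊(ratio n η p μ S δ) ^ (1 / 3 : ℝ)⌋₊) T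

/-! ### The algorithm -/

/-- `w` is an eigenvector of the Hermitian matrix `B` for its largest eigenvalue. -/
def IsTopEigenvector {n : ℕ} (B : Matrix (Fin n) (Fin n) ℂ) (w : Fin n → ℂ) : Prop :=
  ∃ lam : ℝ, Module.End.HasEigenvector (Matrix.toLin' B) (lam : ℂ) w ∧
    ∀ ν : ℝ, Module.End.HasEigenvalue (Matrix.toLin' B) (ν : ℂ) → ν ≤ lam

/-- Entrywise projection of a complex number onto the unit circle, with `0 ↦ 1`. -/
noncomputable def phase (z : ℂ) : ℂ := if z = 0 then 1 else z / (‖z‖ : ℂ)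

/-- Matrix denoising stage: `Ĝ = 𝒫_{τ,n} A`. -/
noncomputable def gHat {n T : ℕ} (v : Fin T → Fin T → ℝ) (τ : ℕ)
    (A : Fin T → Matrix (Fin n) (Fin n) ℂ) : Matrix (Fin T × Fin n) (Fin n) ℂ :=
  proj n v τ * stack A

/-- Hermitianized block `Ĝ'(k) = (Ĝ(k) + Ĝ(k)ᴴ) / 2`. -/
noncomputable def gHatHerm {n T : ℕ} (v : Fin T → Fin T → ℝ) (τ : ℕ)
    (A : Fin T → Matrix (Fin n) (Fin n) ℂ) (k : Fin T) : Matrix (Fin n) (Fin n) ℂ :=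
  (1 / 2 : ℂ) • (block (gHat v τ A) k + (block (gHat v τ A) k)ᴴ)

/-- `gh` is an output of global matrix denoising followed by local spectral synchronization, on
input `A` and `τ`. The output is a relation, because the top eigenvector `w` of a block is not
unique. In Mathlib `Complex.arg 0 = 0`, which is the convention of the algorithm. -/
def IsOutput {n T : ℕ} [NeZero n] (v : Fin T → Fin T → ℝ) (τ : ℕ)
    (A : Fin T → Matrix (Fin n) (Fin n) ℂ) (gh : Fin T → Fin n → ℂ) : Prop :=
  ∀ k, ∃ w : Fin n → ℂ, IsTopEigenvector (gHatHerm v τ A k) w ∧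
    ∀ i, gh k i = phase (w i) * Complex.exp (-(Complex.I * (Complex.arg (w 0) : ℂ)))

/-! ### The error bounds -/

/-- The general error bound, with constant `C`. -/
noncomputable def generalBound {T : ℕ} (C : ℝ) (n : ℕ) (η : ℝ) (p : Fin T → ℝ) (μ S δ : ℝ) : ℝ :=
  C / ((1 - η) ^ 2 * pMin p ^ 2) *
    (max (μ * dBar η p ^ 2 * n * (T : ℝ) ^ 2 * S / (1 + (ratio n η p μ S δ) ^ (2 / 3 : ℝ)))
        (μ * dBar η p ^ 2 * n * S) * (if tauStar n η p μ S δ < T then 1 else 0)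
      + fTilde η p δ * (n : ℝ) ^ 2 * min (1 + (ratio n η p μ S δ) ^ (1 / 3 : ℝ)) T)

/-- The condition that `T` is large, with constant `C`. -/
def LargeT {T : ℕ} (C : ℝ) (n : ℕ) (η : ℝ) (p : Fin T → ℝ) (μ S δ : ℝ) : Prop :=
  C * max ((n * fTilde η p δ / (μ * dBar η p ^ 2 * S)) ^ (1 / 2 : ℝ))
      (μ * dBar η p ^ 2 * S / (n * fTilde η p δ)) ≤ T

/-- The simplified error bound for large `T`, with constant `C`. -/
noncomputable def simpleBound {T : ℕ} (C : ℝ) (n : ℕ) (η : ℝ) (p : Fin T → ℝ) (μ S δ : ℝ) : ℝ :=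
  C * (fTilde η p δ ^ (2 / 3 : ℝ) / ((1 - η) ^ 2 * pMin p ^ 2)) *
    (μ * dBar η p ^ 2) ^ (1 / 3 : ℝ) * (n : ℝ) ^ (5 / 3 : ℝ) *
    (T : ℝ) ^ (2 / 3 : ℝ) * S ^ (1 / 3 : ℝ)

/-- `good` holds on a measurable event of probability at least `r`. -/
def WithProbAtLeast {Ω : Type*} [MeasurableSpace Ω] (P : Measure Ω) (r : ℝ)
    (good : Ω → Prop) : Prop :=
  ∃ E : Set Ω, MeasurableSet E ∧ r ≤ P.real E ∧ ∀ ω ∈ E, good ω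

/-- The standing assumptions. A connection probability `0` and the level `η = 1`, for which the
error bounds are infinite, are excluded. -/
structure IsSetting {n T : ℕ} [NeZero n] {Ω : Type*} [MeasurableSpace Ω] (P : Measure Ω)
    (v : Fin T → Fin T → ℝ) (η : ℝ) (p : Fin T → ℝ) (g : Fin T → Fin n → ℂ) (S μ : ℝ)
    (A : Ω → Fin T → Matrix (Fin n) (Fin n) ℂ) : Prop where
  prob : IsProbabilityMeasure P
  basis : IsPathEigenbasis v
  eta_nonneg : 0 ≤ η
  eta_lt_one : η < 1
  p_pos : ∀ k, 0 < p k
  p_le_one : ∀ k, p k ≤ 1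
  S_nonneg : 0 ≤ S
  truth : IsGroundTruth g S
  model : IsOutliersModel P η p g A
  mu_ge_one : 1 ≤ μ
  d_smooth : IsDSmooth v η p g μ

end DynSync

namespace DynSync

/-! ### Perturbation of the top eigenvector -/

/-! The estimator is controlled deterministically by the Frobenius error of `gHat`, and that error
splits into bias and projected noise.

Deterministic part (`sum_norm_outer_sub_le`, `distSq_le_frobSq`). For a top eigenvector `w` of a
Hermitian `B`, scale `w wᴴ` to the Frobenius norm of `g gᴴ` and let `X` be the difference.
Optimality of `w` gives `⟨X, B⟩ ≥ 0`. Equality of norms gives `⟨X, g gᴴ⟩ = -‖X‖²/2`, and `X` has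
trace zero, so the `-1` in the target is invisible. Hence `d‖X‖²/2 ≤ ⟨X, E⟩` for `E = B - d (g gᴴ -
1)`, and Cauchy–Schwarz bounds `‖X‖`. No eigengap of `B` is needed. The output is the phase of the
first column of `w wᴴ`, and taking phases costs a factor two.

Bias (`sq_le_mul_eigenvalue`, `frobSq_bias_le`). The `(τ+1)`-st smallest path eigenvalue is at least
`τ²/(4T²)`, so what lies above the cut-off is at most `4T²/τ²` times the Dirichlet energy. The
energy of all the entries `g_i(k) conj g_j(k)` together is at most `4n` times the quadratic
variation. The smoothness of `D` transfers this to `D` times the ground truth.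

Noise (`withProbAtLeast_sum_sq_le`, `IsOutliersModel.withProbAtLeast_frobSq_proj_le`). The projected
noise is a sum of at most `2n²τ` squares of unit-norm combinations, over time, of independent
centered bounded variables. The moments of one observation are governed by `Q`, which gives
subgaussian moments for each combination; Markov's inequality at moment order about `log(1/δ)` then
bounds the sum. Different squares need not be independent. The bound involves only `Q² log(1/δ)`,
which is at most `f̃`.

Rates. `τ*` balances the two terms. With `y = ρ^(1/3)`, the condition on `T` says `1 ≤ y ≤ T`, and
every term is then at most `f̃ n² y`, the simplified bound (`bias_add_noise_le`). In the sparse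
regime `f̃` is of order `log(1/δ)` and `d̄` of order `1/n`. -/

theorem norm_phase (z : ℂ) : ‖phase z‖ = 1 := by
  unfold phase
  split_ifs with h
  · simp
  · simp [h]

theorem phase_smul {c : ℝ} (hc : 0 < c) (z : ℂ) : phase ((c : ℂ) * z) = phase z := by
  unfold phase
  by_cases h : z = 0
  · simp [h]
  · have hc' : (c : ℂ) ≠ 0 := by exact_mod_cast hc.ne'
    have hz : (‖z‖ : ℂ) ≠ 0 := by simpa using h
    rw [if_neg (mul_ne_zero hc' h), if_neg h, norm_mul, Complex.norm_real, Real.norm_of_nonneg hc.le]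
    push_cast
    field_simp

/-- Projecting onto the unit circle at most doubles the distance to a point of the circle. -/
theorem norm_phase_sub_le (z u : ℂ) (hu : ‖u‖ = 1) : ‖phase z - u‖ ≤ 2 * ‖z - u‖ := by
  by_cases h : z = 0
  · subst h
    have : ‖phase 0 - u‖ ≤ ‖phase 0‖ + ‖u‖ := norm_sub_le _ _
    rw [norm_phase, hu] at this
    simp only [zero_sub, norm_neg, hu]
    linarith
  · have hz : (‖z‖ : ℂ) ≠ 0 := by simpa using h
    have h1 : ‖phase z - z‖ = |1 - ‖z‖| := by
      have : phase z - z = ((1 - ‖z‖ : ℝ) : ℂ) * phase z := by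
        unfold phase
        rw [if_neg h]
        push_cast
        field_simp
      rw [this, norm_mul, norm_phase, mul_one, Complex.norm_real, Real.norm_eq_abs]
    have h2 : |1 - ‖z‖| ≤ ‖z - u‖ := by
      rw [← hu, norm_sub_rev z u]
      exact abs_norm_sub_norm_le u z
    calc ‖phase z - u‖ ≤ ‖phase z - z‖ + ‖z - u‖ := norm_sub_le_norm_sub_add_norm_sub _ _ _
      _ ≤ _ := by rw [h1]; linarith

/-- Identifies the anchored output of the algorithm, when the entries do not vanish, with the phase
of an entry of the first column of `w wᴴ`. This removes the phase ambiguity of `w`. -/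
theorem phase_mul_star {a b : ℂ} (ha : a ≠ 0) (hb : b ≠ 0) :
    phase (a * star b) = phase a * Complex.exp (-(Complex.I * (Complex.arg b : ℂ))) := by
  have hb' : (‖b‖ : ℂ) ≠ 0 := by simpa using hb
  have ha' : (‖a‖ : ℂ) ≠ 0 := by simpa using ha
  have hs : star b ≠ 0 := by simpa using hb
  have key : star b = (‖b‖ : ℂ) * Complex.exp (-(Complex.I * (Complex.arg b : ℂ))) := by
    conv_lhs => rw [← Complex.norm_mul_exp_arg_mul_I b]
    simp only [RCLike.star_def, map_mul, Complex.conj_ofReal, ← Complex.exp_conj, Complex.conj_I]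
    congr 2
    ring
  unfold phase
  rw [if_neg (mul_ne_zero ha hs), if_neg ha, norm_mul, norm_star]
  rw [key]
  push_cast
  field_simp

theorem frobSq_nonneg {ι κ : Type*} [Fintype ι] [Fintype κ] (X : Matrix ι κ ℂ) : 0 ≤ frobSq X := by
  unfold frobSq; positivity

open scoped ComplexOrder in
/-- The Rayleigh quotient of a Hermitian matrix is at most its largest eigenvalue. -/
theorem re_dotProduct_mulVec_le {n : ℕ} {B : Matrix (Fin n) (Fin n) ℂ} (hB : B.IsHermitian)
    {lam : ℝ} (hmax : ∀ ν : ℝ, Module.End.HasEigenvalue (Matrix.toLin' B) (ν : ℂ) → ν ≤ lam)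
    (x : Fin n → ℂ) : (star x ⬝ᵥ (B *ᵥ x)).re ≤ lam * ∑ i, ‖x i‖ ^ 2 := by
  classical
  have hH : ((lam : ℂ) • (1 : Matrix (Fin n) (Fin n) ℂ) - B).IsHermitian := by
    refine Matrix.IsHermitian.sub ?_ hB
    simp [Matrix.IsHermitian, Matrix.conjTranspose_smul]
  have hpos : ((lam : ℂ) • (1 : Matrix (Fin n) (Fin n) ℂ) - B).PosSemidef := by
    rw [hH.posSemidef_iff_eigenvalues_nonneg]
    intro i
    have he := hH.mulVec_eigenvectorBasis i
    have hne : (WithLp.ofLp (hH.eigenvectorBasis i)) ≠ 0 := by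
      intro h0
      have := hH.eigenvectorBasis.orthonormal.ne_zero i
      exact this (by ext j; simpa using congrFun h0 j)
    have hev : Module.End.HasEigenvalue (Matrix.toLin' B)
        ((lam - hH.eigenvalues i : ℝ) : ℂ) := by
      refine Module.End.hasEigenvalue_of_hasEigenvector
        (x := WithLp.ofLp (hH.eigenvectorBasis i)) ⟨?_, hne⟩
      rw [Module.End.mem_eigenspace_iff, Matrix.toLin'_apply]
      rw [Matrix.sub_mulVec, Matrix.smul_mulVec, Matrix.one_mulVec] at he
      have : B *ᵥ WithLp.ofLp (hH.eigenvectorBasis i) =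
          (lam : ℂ) • WithLp.ofLp (hH.eigenvectorBasis i) -
            hH.eigenvalues i • WithLp.ofLp (hH.eigenvectorBasis i) := by
        rw [← he]; abel
      rw [this]
      ext j
      simp [sub_mul]
    have := hmax _ hev
    simp only [Pi.zero_apply]
    linarith
  have h := hpos.re_dotProduct_nonneg x
  rw [Matrix.sub_mulVec, Matrix.smul_mulVec, Matrix.one_mulVec, dotProduct_sub,
    dotProduct_smul] at h
  have hx : star x ⬝ᵥ x = ((∑ i, ‖x i‖ ^ 2 : ℝ) : ℂ) := by
    simp only [dotProduct, Pi.star_apply, RCLike.star_def, Complex.conj_mul']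
    push_cast
    rfl
  rw [hx] at h
  simp only [smul_eq_mul, map_sub, RCLike.re_to_complex, ← Complex.ofReal_mul,
    Complex.ofReal_re] at h
  linarith

/-- Cauchy–Schwarz for the Frobenius inner product, in squared form to avoid square roots. -/
theorem re_sum_mul_le {n : ℕ} (E X : Fin n → Fin n → ℂ) :
    (∑ i, ∑ j, star (X i j) * E i j).re ^ 2
      ≤ (∑ i, ∑ j, ‖E i j‖ ^ 2) * ∑ i, ∑ j, ‖X i j‖ ^ 2 := by
  have h1 : |(∑ i, ∑ j, star (X i j) * E i j).re| ≤ ∑ p : Fin n × Fin n, ‖E p.1 p.2‖ * ‖X p.1 p.2‖ := by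
    refine (Complex.abs_re_le_norm _).trans ?_
    rw [← Fintype.sum_prod_type']
    refine (norm_sum_le _ _).trans (Finset.sum_le_sum fun p _ => ?_)
    rw [norm_mul, norm_star, mul_comm]
  have hE : ∑ i, ∑ j, ‖E i j‖ ^ 2 = ∑ p : Fin n × Fin n, ‖E p.1 p.2‖ ^ 2 :=
    (Fintype.sum_prod_type' fun i j => ‖E i j‖ ^ 2).symm
  have hX : ∑ i, ∑ j, ‖X i j‖ ^ 2 = ∑ p : Fin n × Fin n, ‖X p.1 p.2‖ ^ 2 :=
    (Fintype.sum_prod_type' fun i j => ‖X i j‖ ^ 2).symm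
  rw [hE, hX, ← sq_abs]
  calc _ ≤ (∑ p : Fin n × Fin n, ‖E p.1 p.2‖ * ‖X p.1 p.2‖) ^ 2 := by gcongr
    _ ≤ _ := Finset.sum_mul_sq_le_sq_mul_sq _ _ _

theorem le_div_sq_of_sq_le {d N F : ℝ} (hd : 0 < d) (hN : 0 ≤ N) (hF : 0 ≤ F)
    (h : (d * N / 2) ^ 2 ≤ F * N) : N ≤ 4 * F / d ^ 2 := by
  rw [le_div_iff₀ (by positivity)]
  rcases hN.eq_or_lt with h0 | h0
  · rw [← h0, zero_mul]; positivity
  · have : N * (N * d ^ 2) ≤ N * (4 * F) := by linarith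
    exact le_of_mul_le_mul_left this h0

/-- Frobenius perturbation bound for a top eigenvector of a perturbed rank one matrix. -/
theorem sum_norm_outer_sub_le {n : ℕ} [NeZero n] {B : Matrix (Fin n) (Fin n) ℂ}
    (hB : B.IsHermitian) {w g : Fin n → ℂ} (hw : IsTopEigenvector B w) (hg : ∀ i, ‖g i‖ = 1)
    {d : ℝ} (hd : 0 < d) {s : ℝ} (hs : s = ∑ i, ‖w i‖ ^ 2) :
    0 < s ∧ ∑ i, ∑ j, ‖((n / s : ℝ) : ℂ) * (w i * star (w j)) - g i * star (g j)‖ ^ 2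
      ≤ 4 * frobSq (B - (d : ℂ) • (Matrix.vecMulVec g (star g) - 1)) / d ^ 2 := by
  classical
  obtain ⟨lam, ⟨hev, hne⟩, hmax⟩ := hw
  have hspos : 0 < s := by
    rw [hs]
    obtain ⟨i, hi⟩ := Function.ne_iff.mp hne
    exact Finset.sum_pos' (fun _ _ => by positivity)
      ⟨i, Finset.mem_univ _, by have : 0 < ‖w i‖ := norm_pos_iff.mpr hi
                                positivity⟩
  refine ⟨hspos, ?_⟩
  have hn : (0 : ℝ) < n := by exact_mod_cast Nat.pos_of_ne_zero (NeZero.ne n)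
  -- With this scaling `c w wᴴ` and `g gᴴ` have the same trace `n` and the same Frobenius norm `n`.
  set c : ℝ := n / s with hc
  have hcs : c * s = n := by rw [hc]; field_simp
  set E := B - (d : ℂ) • (Matrix.vecMulVec g (star g) - 1) with hE
  set X : Fin n → Fin n → ℂ := fun i j => (c : ℂ) * (w i * star (w j)) - g i * star (g j) with hX
  -- the quadratic forms of `B`
  have hquad : ∀ y : Fin n → ℂ, star y ⬝ᵥ (B *ᵥ y) = ∑ i, ∑ j, star (y i * star (y j)) * B i j := by
    intro y
    simp only [dotProduct, Matrix.mulVec, Finset.mul_sum, Pi.star_apply, star_mul', star_star]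
    refine Finset.sum_congr rfl fun i _ => Finset.sum_congr rfl fun j _ => by ring
  have hBw : (star w ⬝ᵥ (B *ᵥ w)).re = lam * s := by
    rw [Module.End.mem_eigenspace_iff, Matrix.toLin'_apply] at hev
    have hx : star w ⬝ᵥ w = ((∑ i, ‖w i‖ ^ 2 : ℝ) : ℂ) := by
      simp only [dotProduct, Pi.star_apply, RCLike.star_def, Complex.conj_mul']
      push_cast
      rfl
    rw [hev, dotProduct_smul, hx, ← hs, smul_eq_mul, ← Complex.ofReal_mul, Complex.ofReal_re]
  have hBg : (star g ⬝ᵥ (B *ᵥ g)).re ≤ lam * n := by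
    have := re_dotProduct_mulVec_le hB hmax g
    simpa [hg] using this
  -- Since `c * s = n`, the form of `B` at the scaled `w` is `lam * n`, the largest value available
  -- to a vector of squared norm `n` such as `g`.
  have hBX : 0 ≤ (∑ i, ∑ j, star (X i j) * B i j).re := by
    have : ∑ i, ∑ j, star (X i j) * B i j =
        (c : ℂ) * (star w ⬝ᵥ (B *ᵥ w)) - star g ⬝ᵥ (B *ᵥ g) := by
      rw [hquad, hquad, Finset.mul_sum, ← Finset.sum_sub_distrib]
      refine Finset.sum_congr rfl fun i _ => ?_
      rw [Finset.mul_sum, ← Finset.sum_sub_distrib]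
      refine Finset.sum_congr rfl fun j _ => ?_
      simp only [hX, star_sub, star_mul', RCLike.star_def, Complex.conj_ofReal]
      ring
    rw [this, Complex.sub_re, Complex.re_ofReal_mul, hBw]
    have : c * (lam * s) = lam * n := by rw [← hcs]; ring
    linarith
  have hXtr : ∑ i, X i i = 0 := by
    simp only [hX, Finset.sum_sub_distrib, ← Finset.mul_sum, RCLike.star_def, Complex.mul_conj',
      hg, Complex.ofReal_one, one_pow]
    have : (∑ i, ((‖w i‖ : ℂ)) ^ 2) = (s : ℂ) := by rw [hs]; push_cast; rfl
    rw [this]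
    have hcs' : (c : ℂ) * s = n := by exact_mod_cast hcs
    simp [hcs']
  have hsumW : ∑ i, ∑ j, ‖(c : ℂ) * (w i * star (w j))‖ ^ 2 = (n : ℝ) ^ 2 := by
    have hc0 : 0 ≤ c := by positivity
    simp only [norm_mul, norm_star, mul_pow, Complex.norm_real, Real.norm_eq_abs, sq_abs]
    simp only [← Finset.mul_sum, ← Finset.sum_mul, ← hs]
    rw [← hcs]; ring
  have hsumG : ∑ i, ∑ j, ‖g i * star (g j)‖ ^ 2 = (n : ℝ) ^ 2 := by
    simp [hg, sq]
  -- polarization, using that both outer products have the same norm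
  have hpol : (∑ i, ∑ j, star (X i j) * (g i * star (g j))).re
      = - (∑ i, ∑ j, ‖X i j‖ ^ 2) / 2 := by
    have key : ∀ i j, (star (X i j) * (g i * star (g j))).re =
        (‖(c : ℂ) * (w i * star (w j))‖ ^ 2 - ‖X i j‖ ^ 2 - ‖g i * star (g j)‖ ^ 2) / 2 := by
      intro i j
      have : (c : ℂ) * (w i * star (w j)) = X i j + g i * star (g j) := by simp [hX]
      rw [this]
      generalize X i j = a
      generalize g i * star (g j) = b
      simp only [← Complex.normSq_eq_norm_sq, Complex.normSq_apply, Complex.add_re, Complex.add_im,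
        RCLike.star_def, Complex.mul_re, Complex.conj_re, Complex.conj_im]
      ring
    simp only [Complex.re_sum, key]
    simp only [← Finset.sum_div, Finset.sum_sub_distrib, hsumW, hsumG]
    ring
  -- Expand `B = E + d (g gᴴ - 1)`: the identity pairs with the zero trace of `X`, and the rank one
  -- part contributes `-d‖X‖²/2`.
  have hEX : d * (∑ i, ∑ j, ‖X i j‖ ^ 2) / 2 ≤ (∑ i, ∑ j, star (X i j) * E i j).re := by
    have hdec : ∑ i, ∑ j, star (X i j) * B i j = ∑ i, ∑ j, star (X i j) * E i j
        + (d : ℂ) * (∑ i, ∑ j, star (X i j) * (g i * star (g j))) - (d : ℂ) * star (∑ i, X i i) := by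
      have h1 : star (∑ i, X i i) = ∑ i, ∑ j, star (X i j) * (1 : Matrix (Fin n) (Fin n) ℂ) i j := by
        simp [Matrix.one_apply, star_sum]
      rw [h1]
      simp only [Finset.mul_sum, ← Finset.sum_add_distrib, ← Finset.sum_sub_distrib]
      refine Finset.sum_congr rfl fun i _ => Finset.sum_congr rfl fun j _ => ?_
      simp only [hE, Matrix.sub_apply, Matrix.smul_apply, Matrix.vecMulVec_apply, Pi.star_apply,
        smul_eq_mul]
      ring
    rw [hXtr, star_zero, mul_zero, sub_zero] at hdec
    rw [hdec, Complex.add_re, Complex.re_ofReal_mul, hpol] at hBX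
    linarith
  have hcs := re_sum_mul_le E X
  have hfE : ∑ i, ∑ j, ‖E i j‖ ^ 2 = frobSq E := rfl
  rw [hfE] at hcs
  set N := ∑ i, ∑ j, ‖X i j‖ ^ 2 with hN
  have hN0 : 0 ≤ N := Finset.sum_nonneg fun i _ => Finset.sum_nonneg fun j _ => sq_nonneg _
  have hF0 : 0 ≤ frobSq E := frobSq_nonneg E
  have h3 : (d * N / 2) ^ 2 ≤ frobSq E * N :=
    (pow_le_pow_left₀ (div_nonneg (mul_nonneg hd.le hN0) zero_le_two) hEX 2).trans hcs
  exact le_div_sq_of_sq_le hd hN0 hF0 h3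

/-- Error of one block of local spectral synchronization. -/
theorem sum_norm_output_sub_le {n : ℕ} [NeZero n] {B : Matrix (Fin n) (Fin n) ℂ}
    (hB : B.IsHermitian) {w g gh : Fin n → ℂ} (hw : IsTopEigenvector B w) (hg : ∀ i, ‖g i‖ = 1)
    (hg0 : g 0 = 1)
    (hgh : ∀ i, gh i = phase (w i) * Complex.exp (-(Complex.I * (Complex.arg (w 0) : ℂ))))
    {d : ℝ} (hd : 0 < d) :
    ∑ i, ‖gh i - g i‖ ^ 2
      ≤ 16 * frobSq (B - (d : ℂ) • (Matrix.vecMulVec g (star g) - 1)) / d ^ 2 := by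
  obtain ⟨hs, hX⟩ := sum_norm_outer_sub_le hB hw hg hd rfl
  set s := ∑ i, ‖w i‖ ^ 2
  have hn : (0 : ℝ) < n := by exact_mod_cast Nat.pos_of_ne_zero (NeZero.ne n)
  have hc : 0 < (n : ℝ) / s := by positivity
  have hgh1 : ∀ i, ‖gh i‖ = 1 := by
    intro i
    rw [hgh, norm_mul, norm_phase, one_mul, Complex.norm_exp]
    simp
  have hi : ∀ i, ‖gh i - g i‖ ≤ 2 * ‖((n / s : ℝ) : ℂ) * (w i * star (w 0)) - g i * star (g 0)‖ := by
    intro i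
    rw [hg0, star_one, mul_one]
    -- If the product vanishes, the conventions for the phase and argument of `0` play no role: the
    -- outer product misses `g i` by exactly `1`, and two unit numbers differ by at most `2`.
    by_cases h : w i * star (w 0) = 0
    · rw [h, mul_zero, zero_sub, norm_neg, hg]
      refine (norm_sub_le _ _).trans ?_
      rw [hgh1, hg]; norm_num
    · have h1 : w i ≠ 0 := left_ne_zero_of_mul h
      have h2 : w 0 ≠ 0 := by simpa using right_ne_zero_of_mul h
      rw [hgh, ← phase_mul_star h1 h2, ← phase_smul hc]
      exact norm_phase_sub_le _ _ (hg i)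
  have hcol : ∑ i, ‖((n / s : ℝ) : ℂ) * (w i * star (w 0)) - g i * star (g 0)‖ ^ 2
      ≤ ∑ i, ∑ j, ‖((n / s : ℝ) : ℂ) * (w i * star (w j)) - g i * star (g j)‖ ^ 2 :=
    Finset.sum_le_sum fun i _ => Finset.single_le_sum
      (f := fun j => ‖((n / s : ℝ) : ℂ) * (w i * star (w j)) - g i * star (g j)‖ ^ 2)
      (fun _ _ => by positivity) (Finset.mem_univ 0)
  calc ∑ i, ‖gh i - g i‖ ^ 2
      ≤ ∑ i, 4 * ‖((n / s : ℝ) : ℂ) * (w i * star (w 0)) - g i * star (g 0)‖ ^ 2 := by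
        refine Finset.sum_le_sum fun i _ => ?_
        have := pow_le_pow_left₀ (norm_nonneg _) (hi i) 2
        rw [mul_pow] at this
        linarith
    _ ≤ 4 * (4 * frobSq (B - (d : ℂ) • (Matrix.vecMulVec g (star g) - 1)) / d ^ 2) := by
        rw [← Finset.mul_sum]
        linarith
    _ = _ := by ring

/-! ### Frobenius norm identities and the blockwise reduction to the denoised matrix. -/

theorem frobSq_add_le {ι κ : Type*} [Fintype ι] [Fintype κ] (X Y : Matrix ι κ ℂ) :
    frobSq (X + Y) ≤ 2 * frobSq X + 2 * frobSq Y := by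
  unfold frobSq
  simp only [Finset.mul_sum, ← Finset.sum_add_distrib]
  refine Finset.sum_le_sum fun i _ => Finset.sum_le_sum fun j _ => ?_
  have h := pow_le_pow_left₀ (norm_nonneg _) (norm_add_le (X i j) (Y i j)) 2
  rw [Matrix.add_apply]
  nlinarith [sq_nonneg (‖X i j‖ - ‖Y i j‖)]

theorem frobSq_conjTranspose {ι κ : Type*} [Fintype ι] [Fintype κ] (X : Matrix ι κ ℂ) :
    frobSq Xᴴ = frobSq X := by
  unfold frobSq
  rw [Finset.sum_comm]
  simp [Matrix.conjTranspose_apply]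

theorem frobSq_smul {ι κ : Type*} [Fintype ι] [Fintype κ] (c : ℂ) (X : Matrix ι κ ℂ) :
    frobSq (c • X) = ‖c‖ ^ 2 * frobSq X := by
  unfold frobSq
  simp [Finset.mul_sum, mul_pow]

theorem frobSq_hermitianPart_le {n : ℕ} (X : Matrix (Fin n) (Fin n) ℂ) :
    frobSq ((1 / 2 : ℂ) • (X + Xᴴ)) ≤ frobSq X := by
  rw [frobSq_smul]
  have h := frobSq_add_le X Xᴴ
  rw [frobSq_conjTranspose] at h
  norm_num
  linarith

theorem sum_frobSq_block {n T : ℕ} (X : Matrix (Fin T × Fin n) (Fin n) ℂ) :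
    ∑ k, frobSq (block X k) = frobSq X := by
  unfold frobSq block
  rw [Fintype.sum_prod_type]

/-- Error of the two-stage algorithm in terms of the error of the denoised matrix. -/
theorem distSq_le_frobSq {n T : ℕ} [NeZero n] (v : Fin T → Fin T → ℝ) (τ : ℕ)
    (A : Fin T → Matrix (Fin n) (Fin n) ℂ) {g gh : Fin T → Fin n → ℂ}
    (hg : ∀ k i, ‖g k i‖ = 1) (hg0 : ∀ k, g k 0 = 1) (hgh : IsOutput v τ A gh)
    {η : ℝ} {p : Fin T → ℝ} {d : ℝ} (hd : 0 < d) (hdk : ∀ k, d ≤ (1 - η) * p k) :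
    distSq gh g ≤ 16 / d ^ 2 * frobSq (gHat v τ A - dMat n η p * gBar g) := by
  unfold distSq
  rw [← sum_frobSq_block, Finset.mul_sum]
  refine Finset.sum_le_sum fun k _ => ?_
  obtain ⟨w, hw, hwk⟩ := hgh k
  have hB : (gHatHerm v τ A k).IsHermitian := by
    unfold gHatHerm Matrix.IsHermitian
    rw [Matrix.conjTranspose_smul, Matrix.conjTranspose_add, Matrix.conjTranspose_conjTranspose,
      add_comm]
    simp
  have hdk0 : 0 < (1 - η) * p k := hd.trans_le (hdk k)
  have h := sum_norm_output_sub_le hB hw (hg k) (hg0 k) hwk hdk0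
  have hH : (Matrix.vecMulVec (g k) (star (g k)) - 1)ᴴ = Matrix.vecMulVec (g k) (star (g k)) - 1 := by
    ext i j
    simp [Matrix.conjTranspose_apply, Matrix.vecMulVec_apply, Matrix.one_apply, mul_comm, eq_comm]
  -- The target block is Hermitian, so symmetrizing the estimate symmetrizes the error, which does
  -- not increase its norm.
  have hE : gHatHerm v τ A k - (((1 - η) * p k : ℝ) : ℂ) • (Matrix.vecMulVec (g k) (star (g k)) - 1)
      = (1 / 2 : ℂ) • (block (gHat v τ A - dMat n η p * gBar g) k
        + (block (gHat v τ A - dMat n η p * gBar g) k)ᴴ) := by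
    have hb : block (gHat v τ A - dMat n η p * gBar g) k = block (gHat v τ A) k
        - (((1 - η) * p k : ℝ) : ℂ) • (Matrix.vecMulVec (g k) (star (g k)) - 1) := by
      ext i j
      simp only [block, dMat, gBar, stack, Matrix.sub_apply, Matrix.diagonal_mul,
        Matrix.smul_apply, smul_eq_mul]
    rw [hb, Matrix.conjTranspose_sub, Matrix.conjTranspose_smul, hH]
    unfold gHatHerm
    simp only [RCLike.star_def, Complex.conj_ofReal]
    module
  rw [hE] at h
  refine h.trans ?_
  have h2 := frobSq_hermitianPart_le (block (gHat v τ A - dMat n η p * gBar g) k)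
  have h3 := frobSq_nonneg (block (gHat v τ A - dMat n η p * gBar g) k)
  rw [div_mul_eq_mul_div]
  have := hdk k
  gcongr

/-! ### Spectral gap of the path and low-frequency projections -/

section Path

variable {T : ℕ}

/-- Completeness of the family: for a square matrix `V`, `V Vᵀ = 1` forces `Vᵀ V = 1`. -/
theorem IsPathEigenbasis.sum_dotProduct_mul {v : Fin T → Fin T → ℝ} (hv : IsPathEigenbasis v)
    (x : Fin T → ℝ) (k : Fin T) : ∑ l, (v l ⬝ᵥ x) * v l k = x k := by
  have h1 : Matrix.of v * (Matrix.of v)ᵀ = 1 := by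
    ext i j
    rw [Matrix.mul_apply, Matrix.one_apply, ← hv.orthonormal i j]
    rfl
  have h2 : (Matrix.of v)ᵀ * Matrix.of v = 1 := mul_eq_one_comm.mp h1
  have h3 : ((Matrix.of v)ᵀ * Matrix.of v) *ᵥ x = x := by rw [h2, Matrix.one_mulVec]
  rw [← Matrix.mulVec_mulVec] at h3
  have h4 := congrFun h3 k
  rw [← h4]
  simp only [Matrix.mulVec, dotProduct, Matrix.transpose_apply, Matrix.of_apply]
  exact Finset.sum_congr rfl fun l _ => mul_comm _ _

theorem IsPathEigenbasis.sum_sq_combination {v : Fin T → Fin T → ℝ} (hv : IsPathEigenbasis v)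
    (s : Finset (Fin T)) (c : Fin T → ℝ) :
    ∑ k, (∑ l ∈ s, c l * v l k) ^ 2 = ∑ l ∈ s, c l ^ 2 := by
  have h : ∀ l ∈ s, ∑ l' ∈ s, c l * c l' * (v l ⬝ᵥ v l') = c l ^ 2 := by
    intro l hl
    simp [hv.orthonormal, hl, sq]
  rw [← Finset.sum_congr rfl h]
  have hk : ∀ k, (∑ l ∈ s, c l * v l k) ^ 2
      = ∑ l ∈ s, ∑ l' ∈ s, c l * c l' * (v l k * v l' k) := by
    intro k
    rw [sq, Finset.sum_mul_sum]
    exact Finset.sum_congr rfl fun l _ => Finset.sum_congr rfl fun l' _ => by ring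
  simp only [hk, dotProduct, Finset.mul_sum]
  rw [Finset.sum_comm]
  refine Finset.sum_congr rfl fun l _ => ?_
  rw [Finset.sum_comm]

theorem lowFreq_mulVec (v : Fin T → Fin T → ℝ) (τ : ℕ) (x : Fin T → ℝ) (k : Fin T) :
    (lowFreq v τ *ᵥ x) k = ∑ l : Fin T with T ≤ l.val + τ, (v l ⬝ᵥ x) * v l k := by
  unfold lowFreq
  rw [Matrix.sum_mulVec, Finset.sum_apply]
  refine Finset.sum_congr rfl fun l _ => ?_
  simp only [Matrix.mulVec, Matrix.vecMulVec_apply, dotProduct, Finset.sum_mul]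
  exact Finset.sum_congr rfl fun j _ => by ring

theorem IsPathEigenbasis.one_sub_lowFreq_mulVec {v : Fin T → Fin T → ℝ} (hv : IsPathEigenbasis v)
    (τ : ℕ) (x : Fin T → ℝ) (k : Fin T) :
    ((1 - lowFreq v τ) *ᵥ x) k = ∑ l : Fin T with ¬ T ≤ l.val + τ, (v l ⬝ᵥ x) * v l k := by
  rw [Matrix.sub_mulVec, Matrix.one_mulVec, Pi.sub_apply, lowFreq_mulVec]
  conv_lhs => rw [← hv.sum_dotProduct_mul x k]
  rw [← Finset.sum_filter_add_sum_filter_not Finset.univ (fun l : Fin T => T ≤ l.val + τ)]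
  ring

theorem IsPathEigenbasis.sum_sq_lowFreq {v : Fin T → Fin T → ℝ} (hv : IsPathEigenbasis v)
    (τ : ℕ) (x : Fin T → ℝ) :
    ∑ k, (lowFreq v τ *ᵥ x) k ^ 2 = ∑ l : Fin T with T ≤ l.val + τ, (v l ⬝ᵥ x) ^ 2 := by
  simp only [lowFreq_mulVec, hv.sum_sq_combination]

theorem IsPathEigenbasis.sum_sq_one_sub_lowFreq {v : Fin T → Fin T → ℝ}
    (hv : IsPathEigenbasis v) (τ : ℕ) (x : Fin T → ℝ) :
    ∑ k, ((1 - lowFreq v τ) *ᵥ x) k ^ 2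
      = ∑ l : Fin T with ¬ T ≤ l.val + τ, (v l ⬝ᵥ x) ^ 2 := by
  simp only [hv.one_sub_lowFreq_mulVec, hv.sum_sq_combination]

theorem IsPathEigenbasis.sum_sq {v : Fin T → Fin T → ℝ} (hv : IsPathEigenbasis v)
    (x : Fin T → ℝ) : ∑ k, x k ^ 2 = ∑ l, (v l ⬝ᵥ x) ^ 2 := by
  rw [← hv.sum_sq_combination Finset.univ fun l => v l ⬝ᵥ x]
  simp only [hv.sum_dotProduct_mul]

/-- The Dirichlet form of the path. -/
noncomputable def pathEnergy (x : Fin T → ℝ) : ℝ :=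
  ∑ e : Fin (T - 1), (x ⟨e.val, by omega⟩ - x ⟨e.val + 1, by omega⟩) ^ 2

theorem transpose_incidence_mulVec (x : Fin T → ℝ) (e : Fin (T - 1)) :
    ((incidence T)ᵀ *ᵥ x) e = x ⟨e.val, by omega⟩ - x ⟨e.val + 1, by omega⟩ := by
  have h : ∀ i : Fin T, incidence T i e * x i =
      (if i = ⟨e.val, by omega⟩ then x i else 0) - (if i = ⟨e.val + 1, by omega⟩ then x i else 0) := by
    intro i
    unfold incidence
    simp only [Fin.ext_iff]
    split_ifs with h1 h2 <;> first | omega | simp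
  simp only [Matrix.mulVec, dotProduct, Matrix.transpose_apply, h, Finset.sum_sub_distrib,
    Finset.sum_ite_eq', Finset.mem_univ, if_true]

theorem dotProduct_pathLaplacian (x : Fin T → ℝ) : x ⬝ᵥ (pathLaplacian T *ᵥ x) = pathEnergy x := by
  unfold pathLaplacian pathEnergy
  rw [← Matrix.mulVec_mulVec, Matrix.dotProduct_mulVec, ← Matrix.mulVec_transpose]
  simp only [dotProduct, transpose_incidence_mulVec, sq]

theorem pathEnergy_eq_sum {v : Fin T → Fin T → ℝ} (hv : IsPathEigenbasis v) {lam : Fin T → ℝ}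
    (hlam : ∀ j, pathLaplacian T *ᵥ v j = lam j • v j) (x : Fin T → ℝ) :
    pathEnergy x = ∑ l, lam l * (v l ⬝ᵥ x) ^ 2 := by
  have hx : x = ∑ l, (v l ⬝ᵥ x) • v l := by
    ext k
    simp only [Finset.sum_apply, Pi.smul_apply, smul_eq_mul]
    exact (hv.sum_dotProduct_mul x k).symm
  rw [← dotProduct_pathLaplacian]
  conv_lhs => rw [hx, Matrix.mulVec_sum, ← hx]
  rw [dotProduct_sum]
  refine Finset.sum_congr rfl fun l _ => ?_
  rw [Matrix.mulVec_smul, hlam, dotProduct_smul, dotProduct_smul, dotProduct_comm x]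
  simp only [smul_eq_mul]
  ring

/-- Discrete Poincaré inequality for a sequence vanishing at the multiples of `L`. -/
theorem sum_sq_le_of_vanish (y : ℕ → ℝ) (L : ℕ) (hL : 0 < L)
    (hy : ∀ m, L * m < T → y (L * m) = 0) :
    ∑ i ∈ Finset.range T, y i ^ 2
      ≤ (L : ℝ) ^ 2 * ∑ e ∈ Finset.range (T - 1), (y e - y (e + 1)) ^ 2 := by
  -- Telescope from the last multiple of `L` below `i`, at most `L` edges away, and apply
  -- Cauchy–Schwarz. Each edge then serves at most `L` indices `i`, which supplies the second factor
  -- `L`.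
  have hpt : ∀ i ∈ Finset.range T, y i ^ 2 ≤ L * ∑ e ∈ Finset.range (T - 1),
      if e < i ∧ i ≤ e + L then (y e - y (e + 1)) ^ 2 else 0 := by
    intro i hi
    rw [Finset.mem_range] at hi
    set a := L * (i / L) with ha
    have hai : a ≤ i := Nat.mul_div_le i L
    have hai' : i < a + L := by
      have := Nat.lt_mul_div_succ i hL
      rw [Nat.mul_succ] at this
      exact this
    have h0 : y a = 0 := hy _ (hai.trans_lt hi)
    have htel : y i = ∑ e ∈ Finset.Ico a i, (y (e + 1) - y e) := by
      rw [Finset.sum_Ico_sub _ hai, h0, sub_zero]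
    have hcs := sq_sum_le_card_mul_sum_sq (s := Finset.Ico a i) (f := fun e => y (e + 1) - y e)
    rw [← htel] at hcs
    refine hcs.trans ?_
    rw [← Finset.sum_filter]
    have hcard : ((Finset.Ico a i).card : ℝ) ≤ L := by
      rw [Nat.card_Ico]; exact_mod_cast (by omega : i - a ≤ L)
    gcongr
    have hsub : Finset.Ico a i ⊆ (Finset.range (T - 1)).filter fun e => e < i ∧ i ≤ e + L := by
      intro e he
      simp only [Finset.mem_Ico, Finset.mem_filter, Finset.mem_range] at he ⊢
      omega
    calc ∑ e ∈ Finset.Ico a i, (y (e + 1) - y e) ^ 2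
        = ∑ e ∈ Finset.Ico a i, (y e - y (e + 1)) ^ 2 :=
          Finset.sum_congr rfl fun e _ => by ring
      _ ≤ _ := Finset.sum_le_sum_of_subset_of_nonneg hsub fun _ _ _ => sq_nonneg _
  refine (Finset.sum_le_sum hpt).trans ?_
  rw [← Finset.mul_sum, Finset.sum_comm, sq, mul_assoc]
  gcongr
  rw [Finset.mul_sum]
  refine Finset.sum_le_sum fun e _ => ?_
  rw [← Finset.sum_filter, Finset.sum_const, nsmul_eq_mul]
  gcongr
  calc ((Finset.range T).filter fun i => e < i ∧ i ≤ e + L).card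
      ≤ (Finset.Ioc e (e + L)).card := by
        refine Finset.card_le_card fun i hi => ?_
        simp only [Finset.mem_filter, Finset.mem_Ioc] at hi ⊢
        exact hi.2
    _ = L := by simp

theorem sum_sq_le_pathEnergy (x : Fin T → ℝ) (L : ℕ) (hL : 0 < L)
    (hx : ∀ i : Fin T, L ∣ i.val → x i = 0) :
    ∑ i, x i ^ 2 ≤ (L : ℝ) ^ 2 * pathEnergy x := by
  set y : ℕ → ℝ := fun i => if h : i < T then x ⟨i, h⟩ else 0 with hy
  have h := sum_sq_le_of_vanish (T := T) y L hL (by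
    intro m hm
    simp only [hy, hm, dif_pos]
    exact hx _ (dvd_mul_right _ _))
  have h1 : ∑ i, x i ^ 2 = ∑ i ∈ Finset.range T, y i ^ 2 := by
    rw [← Fin.sum_univ_eq_sum_range (fun i => y i ^ 2)]
    simp [hy]
  have h2 : pathEnergy x = ∑ e ∈ Finset.range (T - 1), (y e - y (e + 1)) ^ 2 := by
    rw [← Fin.sum_univ_eq_sum_range (fun e => (y e - y (e + 1)) ^ 2)]
    unfold pathEnergy
    refine Finset.sum_congr rfl fun e _ => ?_
    have he1 : e.val < T := by omega
    have he2 : e.val + 1 < T := by omega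
    simp only [hy, dif_pos he1, dif_pos he2]
  rw [h1, h2]
  exact h

/-- Lower bound for the `(τ + 1)`-st smallest eigenvalue of the path Laplacian. -/
theorem sq_le_mul_eigenvalue {v : Fin T → Fin T → ℝ} (hv : IsPathEigenbasis v)
    {lam : Fin T → ℝ} (hanti : Antitone lam)
    (hlam : ∀ j, pathLaplacian T *ᵥ v j = lam j • v j) {τ : ℕ} (hτ : 1 ≤ τ) (hτT : τ < T) :
    (τ : ℝ) ^ 2 ≤ 4 * (T : ℝ) ^ 2 * lam ⟨T - 1 - τ, by omega⟩ := by
  -- The ceiling of `T / τ`: every multiple of `L` below `T` is then `L * m` with `m < τ`, while `L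
  -- * τ ≤ 2 * T`.
  set L := (T + τ - 1) / τ with hLdef
  have hLτ : T ≤ L * τ := by
    have h1 := Nat.div_add_mod (T + τ - 1) τ
    have h2 := Nat.mod_lt (T + τ - 1) hτ
    rw [← hLdef, mul_comm] at h1
    omega
  have hL2 : L * τ ≤ 2 * T := by
    have := Nat.div_mul_le_self (T + τ - 1) τ
    rw [← hLdef] at this
    omega
  have hL : 0 < L := by
    rcases Nat.eq_zero_or_pos L with h | h
    · rw [h] at hLτ; omega
    · exact h
  -- Dimension count: orthogonality to the top `T - 1 - τ` eigenvectors and vanishing at `τ` points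
  -- are `T - 1` linear conditions on `T` coordinates. A nonzero kernel element lies in the span of
  -- the `τ + 1` lowest modes, so its energy is at most the eigenvalue times its squared norm, while
  -- the Poincaré inequality bounds that energy from below. Points beyond the end of the path impose
  -- an empty condition.
  let F : (Fin T → ℝ) →ₗ[ℝ] ((Fin (T - 1 - τ) → ℝ) × (Fin τ → ℝ)) :=
    { toFun := fun x => (fun l => v ⟨l.val, by omega⟩ ⬝ᵥ x,
        fun m => if h : L * m.val < T then x ⟨L * m.val, h⟩ else 0)
      map_add' := by
        intro x y
        ext m
        · simp [dotProduct_add]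
        · simp only [Prod.mk_add_mk, Pi.add_apply]
          split_ifs <;> simp
      map_smul' := by
        intro c x
        ext m
        · simp [dotProduct_smul]
        · simp only [Prod.smul_mk, Pi.smul_apply, RingHom.id_apply]
          split_ifs <;> simp }
  have hker : LinearMap.ker F ≠ ⊥ := F.ker_ne_bot_of_finrank_lt (by
    rw [Module.finrank_prod, Module.finrank_fin_fun, Module.finrank_fin_fun,
      Module.finrank_fin_fun]
    omega)
  obtain ⟨x, hxker, hx0⟩ := Submodule.exists_mem_ne_zero_of_ne_bot hker
  have hFx : F x = 0 := hxker
  have hlow : ∀ l : Fin T, l.val < T - 1 - τ → v l ⬝ᵥ x = 0 := by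
    intro l hl
    exact congrFun (congrArg Prod.fst hFx) ⟨l.val, hl⟩
  have hvan : ∀ i : Fin T, L ∣ i.val → x i = 0 := by
    rintro i ⟨m, hm⟩
    have hmT : L * m < T := hm ▸ i.isLt
    have hmτ : m < τ := lt_of_mul_lt_mul_left (hmT.trans_le hLτ) (Nat.zero_le L)
    have h := congrFun (congrArg Prod.snd hFx) ⟨m, hmτ⟩
    have h' : (if h : L * m < T then x ⟨L * m, h⟩ else 0) = 0 := h
    rw [dif_pos hmT] at h'
    rw [← h']
    congr 1
    exact Fin.ext hm
  have hpos : 0 < ∑ i, x i ^ 2 := by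
    obtain ⟨i, hi⟩ := Function.ne_iff.mp hx0
    exact Finset.sum_pos' (fun _ _ => sq_nonneg _) ⟨i, Finset.mem_univ _, by
      have : x i ≠ 0 := hi
      positivity⟩
  have hle : pathEnergy x ≤ lam ⟨T - 1 - τ, by omega⟩ * ∑ i, x i ^ 2 := by
    rw [pathEnergy_eq_sum hv hlam, hv.sum_sq x, Finset.mul_sum]
    refine Finset.sum_le_sum fun l _ => ?_
    by_cases hl : l.val < T - 1 - τ
    · simp [hlow l hl]
    · exact mul_le_mul_of_nonneg_right (hanti (by rw [Fin.le_def]; simp only; omega)) (sq_nonneg _)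
  have hP := sum_sq_le_pathEnergy x L hL hvan
  set lm := lam ⟨T - 1 - τ, by omega⟩
  have h1 : (1 : ℝ) ≤ (L : ℝ) ^ 2 * lm := by
    have : 1 * ∑ i, x i ^ 2 ≤ ((L : ℝ) ^ 2 * lm) * ∑ i, x i ^ 2 := by
      rw [one_mul, mul_assoc]
      exact hP.trans (mul_le_mul_of_nonneg_left hle (by positivity))
    exact le_of_mul_le_mul_right this hpos
  have hlm : 0 ≤ lm := by
    by_contra hneg
    push Not at hneg
    nlinarith [sq_nonneg (L : ℝ)]
  have hL2' : (L : ℝ) * τ ≤ 2 * T := by exact_mod_cast hL2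
  have hL2sq : ((L : ℝ) * τ) ^ 2 ≤ (2 * T) ^ 2 := pow_le_pow_left₀ (by positivity) hL2' 2
  calc (τ : ℝ) ^ 2 = (τ : ℝ) ^ 2 * 1 := by ring
    _ ≤ (τ : ℝ) ^ 2 * ((L : ℝ) ^ 2 * lm) := by gcongr
    _ = ((L : ℝ) * τ) ^ 2 * lm := by ring
    _ ≤ (2 * T) ^ 2 * lm := by gcongr
    _ = _ := by ring

/-- The high-frequency part of a signal is controlled by its Dirichlet form. -/
theorem IsPathEigenbasis.sq_mul_sum_sq_one_sub_lowFreq_le {v : Fin T → Fin T → ℝ}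
    (hv : IsPathEigenbasis v) {τ : ℕ} (hτ : 1 ≤ τ) (hτT : τ < T) (x : Fin T → ℝ) :
    (τ : ℝ) ^ 2 * ∑ k, ((1 - lowFreq v τ) *ᵥ x) k ^ 2 ≤ 4 * (T : ℝ) ^ 2 * pathEnergy x := by
  obtain ⟨lam, hanti, hlam⟩ := hv.eigen
  have hgap := sq_le_mul_eigenvalue hv hanti hlam hτ hτT
  have hnn : ∀ l, 0 ≤ lam l := by
    intro l
    have h := dotProduct_pathLaplacian (v l)
    rw [hlam, dotProduct_smul, hv.orthonormal, if_pos rfl, smul_eq_mul, mul_one] at h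
    rw [h]
    exact Finset.sum_nonneg fun _ _ => sq_nonneg _
  rw [hv.sum_sq_one_sub_lowFreq, pathEnergy_eq_sum hv hlam, Finset.mul_sum, Finset.mul_sum]
  calc _ ≤ ∑ l : Fin T with ¬ T ≤ l.val + τ, 4 * (T : ℝ) ^ 2 * (lam l * (v l ⬝ᵥ x) ^ 2) := by
        refine Finset.sum_le_sum fun l hl => ?_
        rw [Finset.mem_filter] at hl
        have : lam ⟨T - 1 - τ, by omega⟩ ≤ lam l := hanti (by rw [Fin.le_def]; simp only; omega)
        rw [← mul_assoc]
        refine mul_le_mul_of_nonneg_right (hgap.trans ?_) (sq_nonneg _)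
        gcongr
    _ ≤ _ := Finset.sum_le_sum_of_subset_of_nonneg (Finset.filter_subset _ _) fun l _ _ => by
        have := hnn l
        positivity

/-! ### From scalar time series to stacked matrices, and the bias at the ground truth. -/

variable {n : ℕ}

theorem kronecker_one_mul_apply (R : Matrix (Fin T) (Fin T) ℝ)
    (X : Matrix (Fin T × Fin n) (Fin n) ℂ) (k : Fin T) (i j : Fin n) :
    ((R.map (fun x : ℝ => (x : ℂ)) ⊗ₖ (1 : Matrix (Fin n) (Fin n) ℂ)) * X) (k, i) j
      = ∑ k', (R k k' : ℂ) * X (k', i) j := by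
  rw [Matrix.mul_apply, Fintype.sum_prod_type]
  refine Finset.sum_congr rfl fun k' _ => ?_
  simp [Matrix.kroneckerMap_apply, Matrix.one_apply]

/-- The Frobenius norm of `(R ⊗ I) X` splits over the real and imaginary parts of the
time series of each entry. -/
theorem frobSq_kronecker_one_mul (R : Matrix (Fin T) (Fin T) ℝ)
    (X : Matrix (Fin T × Fin n) (Fin n) ℂ) :
    frobSq ((R.map (fun x : ℝ => (x : ℂ)) ⊗ₖ (1 : Matrix (Fin n) (Fin n) ℂ)) * X)
      = ∑ i, ∑ j, (∑ k, (R *ᵥ fun k' => (X (k', i) j).re) k ^ 2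
          + ∑ k, (R *ᵥ fun k' => (X (k', i) j).im) k ^ 2) := by
  unfold frobSq
  rw [Fintype.sum_prod_type, Finset.sum_comm]
  refine Finset.sum_congr rfl fun i _ => ?_
  rw [Finset.sum_comm]
  refine Finset.sum_congr rfl fun j _ => ?_
  rw [← Finset.sum_add_distrib]
  refine Finset.sum_congr rfl fun k _ => ?_
  rw [kronecker_one_mul_apply, ← Complex.normSq_eq_norm_sq, Complex.normSq_apply, Complex.re_sum,
    Complex.im_sum]
  simp only [Complex.re_ofReal_mul, Complex.im_ofReal_mul, Matrix.mulVec, dotProduct, sq]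

theorem one_sub_proj (v : Fin T → Fin T → ℝ) (τ : ℕ) :
    1 - proj n v τ = (1 - lowFreq v τ).map (fun x : ℝ => (x : ℂ)) ⊗ₖ
      (1 : Matrix (Fin n) (Fin n) ℂ) := by
  unfold proj
  ext ⟨k, i⟩ ⟨k', i'⟩
  by_cases h : k = k' <;> by_cases h' : i = i' <;>
    simp [Matrix.kroneckerMap_apply, h, h']

theorem IsPathEigenbasis.frobSq_proj_mul {v : Fin T → Fin T → ℝ} (hv : IsPathEigenbasis v)
    (τ : ℕ) (X : Matrix (Fin T × Fin n) (Fin n) ℂ) :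
    frobSq (proj n v τ * X) = ∑ i, ∑ j, ∑ l : Fin T with T ≤ l.val + τ,
      ((v l ⬝ᵥ fun k => (X (k, i) j).re) ^ 2 + (v l ⬝ᵥ fun k => (X (k, i) j).im) ^ 2) := by
  unfold proj
  simp only [frobSq_kronecker_one_mul, hv.sum_sq_lowFreq, Finset.sum_add_distrib]

theorem IsPathEigenbasis.one_sub_proj_self {v : Fin T → Fin T → ℝ} (hv : IsPathEigenbasis v) :
    1 - proj n v T = 0 := by
  have : 1 - lowFreq v T = 0 := by
    rw [← Matrix.toLin'.map_eq_zero_iff]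
    ext x k
    simp only [Matrix.toLin'_apply, LinearMap.comp_apply, hv.one_sub_lowFreq_mulVec]
    simp
  rw [one_sub_proj, this]
  ext ⟨k, i⟩ ⟨k', i'⟩
  simp [Matrix.kroneckerMap_apply]

theorem norm_sub_sq_mul_star_le (a b c d : ℂ) (ha : ‖a‖ = 1) (hd : ‖d‖ = 1) :
    ‖a * star c - b * star d‖ ^ 2 ≤ 2 * ‖a - b‖ ^ 2 + 2 * ‖c - d‖ ^ 2 := by
  have h : ‖a * star c - b * star d‖ ≤ ‖a - b‖ + ‖c - d‖ := by
    have : a * star c - b * star d = a * star (c - d) + (a - b) * star d := by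
      rw [star_sub]; ring
    rw [this]
    refine (norm_add_le _ _).trans ?_
    rw [norm_mul, norm_mul, norm_star, norm_star, ha, hd]
    linarith
  have h2 := pow_le_pow_left₀ (norm_nonneg _) h 2
  nlinarith [sq_nonneg (‖a - b‖ - ‖c - d‖)]

/-- Bias of the low-frequency projection at the ground truth. -/
theorem IsPathEigenbasis.sq_mul_frobSq_one_sub_proj_gBar_le {v : Fin T → Fin T → ℝ}
    (hv : IsPathEigenbasis v) {τ : ℕ} (hτ : 1 ≤ τ) (hτT : τ < T) {g : Fin T → Fin n → ℂ}
    (hg : ∀ k i, ‖g k i‖ = 1) :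
    (τ : ℝ) ^ 2 * frobSq ((1 - proj n v τ) * gBar g) ≤ 16 * (T : ℝ) ^ 2 * n * quadVar g := by
  rw [one_sub_proj, frobSq_kronecker_one_mul, Finset.mul_sum]
  have hE : ∑ i, ∑ j, (pathEnergy (fun k => (gBar g (k, i) j).re)
      + pathEnergy (fun k => (gBar g (k, i) j).im)) ≤ 4 * n * quadVar g := by
    -- The subtracted identity is constant in time and cancels in differences. Summing the two
    -- squares over the free index yields the total `4 * n * quadVar g`.
    have h1 : ∀ i j, pathEnergy (fun k => (gBar g (k, i) j).re)
        + pathEnergy (fun k => (gBar g (k, i) j).im) ≤ ∑ e : Fin (T - 1),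
          (2 * ‖g ⟨e.val, by omega⟩ i - g ⟨e.val + 1, by omega⟩ i‖ ^ 2
            + 2 * ‖g ⟨e.val, by omega⟩ j - g ⟨e.val + 1, by omega⟩ j‖ ^ 2) := by
      intro i j
      unfold pathEnergy
      rw [← Finset.sum_add_distrib]
      refine Finset.sum_le_sum fun e _ => ?_
      refine le_trans (le_of_eq ?_) (norm_sub_sq_mul_star_le _ _ _ _ (hg _ _) (hg _ _))
      rw [← Complex.normSq_eq_norm_sq, Complex.normSq_apply]
      simp only [gBar, stack, Matrix.sub_apply, Matrix.vecMulVec_apply, Pi.star_apply,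
        Complex.sub_re, Complex.sub_im]
      ring
    refine (Finset.sum_le_sum fun i _ => Finset.sum_le_sum fun j _ => h1 i j).trans (le_of_eq ?_)
    unfold quadVar
    simp only [Finset.sum_add_distrib, ← Finset.mul_sum, Finset.sum_const, Finset.card_univ,
      Fintype.card_fin, nsmul_eq_mul]
    have hc : ∀ f : Fin n → Fin (T - 1) → ℝ, ∑ i, ∑ e, f i e = ∑ e, ∑ i, f i e :=
      fun f => Finset.sum_comm
    rw [hc]
    ring
  calc _ ≤ ∑ i, ∑ j, 4 * (T : ℝ) ^ 2 * (pathEnergy (fun k => (gBar g (k, i) j).re)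
      + pathEnergy (fun k => (gBar g (k, i) j).im)) := by
        refine Finset.sum_le_sum fun i _ => ?_
        rw [Finset.mul_sum]
        refine Finset.sum_le_sum fun j _ => ?_
        rw [mul_add, mul_add]
        exact add_le_add (hv.sq_mul_sum_sq_one_sub_lowFreq_le hτ hτT _)
          (hv.sq_mul_sum_sq_one_sub_lowFreq_le hτ hτT _)
    _ = 4 * (T : ℝ) ^ 2 * ∑ i, ∑ j, (pathEnergy (fun k => (gBar g (k, i) j).re)
      + pathEnergy (fun k => (gBar g (k, i) j).im)) := by simp only [Finset.mul_sum]
    _ ≤ 4 * (T : ℝ) ^ 2 * (4 * n * quadVar g) := by gcongr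
    _ = _ := by ring

end Path

/-! ### Moments of sums of independent subgaussian variables -/

section Moments

variable {Ω : Type*} [MeasurableSpace Ω] {P : Measure Ω}

theorem integrable_comp_of_ae_abs_le [IsFiniteMeasure P] {X : Ω → ℝ} (hX : Measurable X) {M : ℝ}
    (hM : ∀ᵐ ω ∂P, |X ω| ≤ M) {φ : ℝ → ℝ} (hφ : Continuous φ) :
    Integrable (fun ω => φ (X ω)) P := by
  obtain ⟨C, hC⟩ := (isCompact_Icc (a := -M) (b := M)).exists_bound_of_continuousOn
    hφ.continuousOn
  refine Integrable.of_bound (hφ.measurable.comp hX).aestronglyMeasurable C ?_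
  filter_upwards [hM] with ω hω
  exact hC _ (abs_le.mp hω)

/-- Isolates the linear term, which integrates to zero for a centered variable and leaves only an
exponential square moment. -/
theorem exp_le_add_exp_sq (x : ℝ) : Real.exp x ≤ x + Real.exp (x ^ 2) := by
  rcases le_or_gt |x| 1 with h | h
  · have h1 := (abs_le.mp (Real.abs_exp_sub_one_sub_id_le h)).2
    have h2 := Real.add_one_le_exp (x ^ 2)
    linarith
  · rcases lt_abs.mp h with h1 | h1
    · have : Real.exp x ≤ Real.exp (x ^ 2) := Real.exp_le_exp.mpr (by nlinarith)
      linarith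
    · have h2 : Real.exp x ≤ 1 := Real.exp_le_one_iff.mpr (by linarith)
      have h3 := Real.add_one_le_exp (x ^ 2)
      nlinarith

theorem exp_one_le_three : Real.exp 1 ≤ 3 := by
  have := Real.exp_one_lt_d9
  linarith

theorem natCast_pow_le_three_pow_mul_factorial (m : ℕ) :
    (m : ℝ) ^ m ≤ 3 ^ m * (m.factorial : ℝ) := by
  have h := Real.pow_div_factorial_le_exp (x := (m : ℝ)) (by positivity) m
  rw [div_le_iff₀ (by positivity)] at h
  have h2 : Real.exp m ≤ 3 ^ m := by
    rw [← Real.exp_one_pow]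
    exact pow_le_pow_left₀ (Real.exp_pos _).le exp_one_le_three m
  exact h.trans (by gcongr)

/-- Expand the exponential in even moments. Since `m ^ m / m! ≤ 3 ^ m`, the series is dominated by a
geometric one of ratio `q = 6 K² s ≤ 1/2`, where `1 / (1 - q) ≤ 1 + 2 q ≤ exp (2 q)`. The almost
sure bound `M` serves integrability only. -/
theorem integral_exp_mul_sq_le [IsProbabilityMeasure P] {X : Ω → ℝ} (hX : Measurable X) {M : ℝ}
    (hM : ∀ᵐ ω ∂P, |X ω| ≤ M) {K : ℝ}
    (hmom : ∀ m : ℕ, 1 ≤ m → ∫ ω, X ω ^ (2 * m) ∂P ≤ (K ^ 2 * (2 * m)) ^ m) {s : ℝ} (hs : 0 ≤ s)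
    (hsK : 12 * K ^ 2 * s ≤ 1) :
    ∫ ω, Real.exp (s * X ω ^ 2) ∂P ≤ Real.exp (12 * K ^ 2 * s) := by
  set q := 6 * K ^ 2 * s with hq
  have hq0 : 0 ≤ q := by positivity
  have hq1 : q ≤ 1 / 2 := by rw [hq]; linarith
  have hterm : ∀ m : ℕ, ∫ ω, (s * X ω ^ 2) ^ m / (m.factorial : ℝ) ∂P ≤ q ^ m := by
    intro m
    rcases Nat.eq_zero_or_pos m with rfl | hm
    · simp
    · have h1 : ∀ ω, (s * X ω ^ 2) ^ m / (m.factorial : ℝ)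
          = s ^ m / (m.factorial : ℝ) * X ω ^ (2 * m) := by
        intro ω; rw [mul_pow, ← pow_mul]; ring
      simp only [h1]
      rw [integral_const_mul]
      have h2 := hmom m hm
      have h3 := natCast_pow_le_three_pow_mul_factorial m
      have hf : (0 : ℝ) < m.factorial := by positivity
      calc s ^ m / (m.factorial : ℝ) * ∫ ω, X ω ^ (2 * m) ∂P
          ≤ s ^ m / (m.factorial : ℝ) * (K ^ 2 * (2 * m)) ^ m := by gcongr
        _ = (2 * K ^ 2 * s) ^ m * ((m : ℝ) ^ m / m.factorial) := by
            simp only [mul_pow]; ring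
        _ ≤ (2 * K ^ 2 * s) ^ m * 3 ^ m := by
            gcongr
            rwa [div_le_iff₀ hf]
        _ = q ^ m := by rw [← mul_pow, hq]; ring
  have hnn : ∀ m : ℕ, ∀ ω, 0 ≤ (s * X ω ^ 2) ^ m / (m.factorial : ℝ) := by
    intro m ω; positivity
  have hgeo := summable_geometric_of_lt_one hq0 (by linarith : q < 1)
  have hsum : Summable fun m : ℕ => ∫ ω, (s * X ω ^ 2) ^ m / (m.factorial : ℝ) ∂P :=
    Summable.of_nonneg_of_le (fun m => integral_nonneg (hnn m)) hterm hgeo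
  have hhas := hasSum_integral_of_summable_integral_norm (μ := P)
    (F := fun (m : ℕ) ω => (s * X ω ^ 2) ^ m / (m.factorial : ℝ))
    (fun m => integrable_comp_of_ae_abs_le hX hM
      (φ := fun x => (s * x ^ 2) ^ m / (m.factorial : ℝ)) (by fun_prop))
    (by simpa only [Real.norm_of_nonneg (hnn _ _)] using hsum)
  have hexp : ∀ ω, ∑' m : ℕ, (s * X ω ^ 2) ^ m / (m.factorial : ℝ) = Real.exp (s * X ω ^ 2) := by
    intro ω
    rw [Real.exp_eq_exp_ℝ, NormedSpace.exp_eq_tsum_div]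
  simp only [hexp] at hhas
  rw [← hhas.tsum_eq]
  calc _ ≤ ∑' m : ℕ, q ^ m := hhas.summable.tsum_le_tsum hterm hgeo
    _ = (1 - q)⁻¹ := tsum_geometric_of_lt_one hq0 (by linarith)
    _ ≤ 1 + 2 * q := by
        rw [inv_le_iff_one_le_mul₀ (by linarith)]
        nlinarith
    _ ≤ Real.exp (2 * q) := by linarith [Real.add_one_le_exp (2 * q)]
    _ = _ := by rw [hq]; ring_nf

/-- Moment growth of subgaussian type bounds the moment generating function of a centered
variable. -/
theorem mgf_le_of_moments [IsProbabilityMeasure P] {X : Ω → ℝ} (hX : Measurable X) {M : ℝ}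
    (hM : ∀ᵐ ω ∂P, |X ω| ≤ M) (h0 : ∫ ω, X ω ∂P = 0) {K : ℝ} (hK : 0 < K)
    (hmom : ∀ m : ℕ, 1 ≤ m → ∫ ω, X ω ^ (2 * m) ∂P ≤ (K ^ 2 * (2 * m)) ^ m) (t : ℝ) :
    mgf X P t ≤ Real.exp (15 * K ^ 2 * t ^ 2) := by
  unfold mgf
  have hi : ∀ φ : ℝ → ℝ, Continuous φ → Integrable (fun ω => φ (X ω)) P :=
    fun φ hφ => integrable_comp_of_ae_abs_le hX hM hφ
  rcases le_or_gt (12 * K ^ 2 * t ^ 2) 1 with h | h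
  · calc ∫ ω, Real.exp (t * X ω) ∂P
        ≤ ∫ ω, (t * X ω + Real.exp (t ^ 2 * X ω ^ 2)) ∂P := by
          refine integral_mono (hi (fun x => Real.exp (t * x)) (by fun_prop))
            (hi (fun x => t * x + Real.exp (t ^ 2 * x ^ 2)) (by fun_prop)) fun ω => ?_
          have := exp_le_add_exp_sq (t * X ω)
          rwa [mul_pow] at this
      _ = ∫ ω, Real.exp (t ^ 2 * X ω ^ 2) ∂P := by
          rw [integral_add (hi (fun x => t * x) (by fun_prop))
            (hi (fun x => Real.exp (t ^ 2 * x ^ 2)) (by fun_prop)), integral_const_mul, h0]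
          ring
      _ ≤ Real.exp (12 * K ^ 2 * t ^ 2) := integral_exp_mul_sq_le hX hM hmom (by positivity) h
      _ ≤ _ := Real.exp_le_exp.mpr (by nlinarith [mul_nonneg (sq_nonneg K) (sq_nonneg t)])
  -- For large `t` centering is not needed: Young's inequality gives `t X ≤ 3 K² t² + s X²`, and the
  -- remaining factor `exp 1` is absorbed because `1 < 12 K² t²`.
  · set s := 1 / (12 * K ^ 2) with hs
    have hs1 : 12 * K ^ 2 * s = 1 := by rw [hs]; field_simp
    calc ∫ ω, Real.exp (t * X ω) ∂P
        ≤ ∫ ω, Real.exp (3 * K ^ 2 * t ^ 2) * Real.exp (s * X ω ^ 2) ∂P := by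
          refine integral_mono (hi (fun x => Real.exp (t * x)) (by fun_prop))
            (hi (fun x => Real.exp (3 * K ^ 2 * t ^ 2) * Real.exp (s * x ^ 2)) (by fun_prop))
            fun ω => ?_
          simp only
          rw [← Real.exp_add]
          refine Real.exp_le_exp.mpr ?_
          have h1 : 3 * K ^ 2 * t ^ 2 + s * X ω ^ 2 - t * X ω
              = 3 * K ^ 2 * (t - X ω / (6 * K ^ 2)) ^ 2 := by
            rw [hs]; field_simp; ring
          have h2 : 0 ≤ 3 * K ^ 2 * (t - X ω / (6 * K ^ 2)) ^ 2 := by positivity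
          linarith
      _ = Real.exp (3 * K ^ 2 * t ^ 2) * ∫ ω, Real.exp (s * X ω ^ 2) ∂P := integral_const_mul _ _
      _ ≤ Real.exp (3 * K ^ 2 * t ^ 2) * Real.exp 1 := by
          gcongr
          rw [← hs1]
          exact integral_exp_mul_sq_le hX hM hmom (by positivity) hs1.le
      _ ≤ _ := by
          rw [← Real.exp_add]
          exact Real.exp_le_exp.mpr (by linarith)

theorem pow_le_factorial_mul_exp_add_exp (m : ℕ) (y : ℝ) {t : ℝ} (ht : 0 < t) :
    y ^ (2 * m) ≤ ((2 * m).factorial : ℝ) / t ^ (2 * m)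
      * (Real.exp (t * y) + Real.exp (-t * y)) := by
  have h := Real.pow_div_factorial_le_exp (x := |t * y|) (abs_nonneg _) (2 * m)
  have h2 : Real.exp |t * y| ≤ Real.exp (t * y) + Real.exp (-t * y) := by
    rcases abs_cases (t * y) with ⟨h, _⟩ | ⟨h, _⟩ <;> rw [h]
    · linarith [Real.exp_pos (-t * y)]
    · rw [neg_mul]; linarith [Real.exp_pos (t * y)]
  have h3 : |t * y| ^ (2 * m) = t ^ (2 * m) * y ^ (2 * m) := by
    rw [pow_mul, sq_abs, ← pow_mul, mul_pow]
  rw [h3, div_le_iff₀ (by positivity)] at h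
  rw [div_mul_eq_mul_div, le_div_iff₀ (by positivity)]
  calc y ^ (2 * m) * t ^ (2 * m) = t ^ (2 * m) * y ^ (2 * m) := mul_comm _ _
    _ ≤ _ := h
    _ ≤ (Real.exp (t * y) + Real.exp (-t * y)) * ((2 * m).factorial : ℝ) := by gcongr
    _ = _ := mul_comm _ _

theorem integral_pow_le_of_mgf_le [IsProbabilityMeasure P] {Y : Ω → ℝ} (hY : Measurable Y) {M : ℝ}
    (hM : ∀ᵐ ω ∂P, |Y ω| ≤ M) {K : ℝ} (hK : 0 < K)
    (hmgf : ∀ t, mgf Y P t ≤ Real.exp (15 * K ^ 2 * t ^ 2)) {m : ℕ} (hm : 1 ≤ m) :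
    ∫ ω, Y ω ^ (2 * m) ∂P ≤ (360 * m * K ^ 2) ^ m := by
  have hi : ∀ φ : ℝ → ℝ, Continuous φ → Integrable (fun ω => φ (Y ω)) P :=
    fun φ hφ => integrable_comp_of_ae_abs_le hY hM hφ
  have hm0 : (0 : ℝ) < m := by exact_mod_cast hm
  -- Chosen so that the exponent in the generating function bound is exactly `m`, which costs only
  -- `3 ^ m` on either side.
  set t := Real.sqrt (m / (15 * K ^ 2)) with ht
  have htpos : 0 < t := Real.sqrt_pos.mpr (by positivity)
  have ht2 : t ^ 2 = m / (15 * K ^ 2) := Real.sq_sqrt (by positivity)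
  have hKt : 15 * K ^ 2 * t ^ 2 = m := by rw [ht2]; field_simp
  have hKt' : 15 * K ^ 2 * (-t) ^ 2 = m := by rw [neg_sq, hKt]
  have hfac : ((2 * m).factorial : ℝ) ≤ (2 * m) ^ (2 * m) := by
    exact_mod_cast Nat.factorial_le_pow (2 * m)
  have hexp : Real.exp m ≤ 3 ^ m := by
    rw [← Real.exp_one_pow]
    exact pow_le_pow_left₀ (Real.exp_pos _).le exp_one_le_three m
  have h1 := hmgf t
  have h2 := hmgf (-t)
  rw [hKt] at h1
  rw [hKt'] at h2
  unfold mgf at h1 h2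
  calc ∫ ω, Y ω ^ (2 * m) ∂P
      ≤ ∫ ω, ((2 * m).factorial : ℝ) / t ^ (2 * m)
          * (Real.exp (t * Y ω) + Real.exp (-t * Y ω)) ∂P :=
        integral_mono (hi (fun x => x ^ (2 * m)) (by fun_prop))
          (hi (fun x => ((2 * m).factorial : ℝ) / t ^ (2 * m)
            * (Real.exp (t * x) + Real.exp (-t * x))) (by fun_prop))
          fun ω => pow_le_factorial_mul_exp_add_exp m (Y ω) htpos
    _ = ((2 * m).factorial : ℝ) / t ^ (2 * m)
          * (∫ ω, Real.exp (t * Y ω) ∂P + ∫ ω, Real.exp (-t * Y ω) ∂P) := by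
        rw [integral_const_mul, integral_add (hi (fun x => Real.exp (t * x)) (by fun_prop))
          (hi (fun x => Real.exp (-t * x)) (by fun_prop))]
    _ ≤ (2 * m) ^ (2 * m) / t ^ (2 * m) * (3 ^ m + 3 ^ m) := by
        gcongr
        · exact h1.trans hexp
        · exact h2.trans hexp
    _ = 2 * (180 * m * K ^ 2) ^ m := by
        have h3 : (2 * (m : ℝ)) ^ (2 * m) / t ^ (2 * m) = (60 * m * K ^ 2) ^ m := by
          rw [pow_mul, pow_mul, ht2, ← div_pow]
          congr 1
          field_simp
          ring
        rw [h3, ← two_mul, show 180 * (m : ℝ) * K ^ 2 = 60 * m * K ^ 2 * 3 by ring, mul_pow _ 3]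
        ring
    _ ≤ 2 ^ m * (180 * m * K ^ 2) ^ m := by
        gcongr
        calc (2 : ℝ) = 2 ^ 1 := by norm_num
          _ ≤ 2 ^ m := pow_le_pow_right₀ (by norm_num) hm
    _ = _ := by rw [← mul_pow]; ring

/-- Even moments of a normalized linear combination of independent centered variables with
moment growth of subgaussian type. -/
theorem integral_dotProduct_pow_le {ι : Type*} [Fintype ι] [IsProbabilityMeasure P]
    {X : ι → Ω → ℝ} (hind : iIndepFun X P) (hX : ∀ k, Measurable (X k)) {M : ℝ}
    (hM : ∀ k, ∀ᵐ ω ∂P, |X k ω| ≤ M) (h0 : ∀ k, ∫ ω, X k ω ∂P = 0) {K : ℝ} (hK : 0 ≤ K)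
    (hmom : ∀ k, ∀ m : ℕ, 1 ≤ m → ∫ ω, X k ω ^ (2 * m) ∂P ≤ (K ^ 2 * (2 * m)) ^ m)
    {v : ι → ℝ} (hv : v ⬝ᵥ v = 1) {m : ℕ} (hm : 1 ≤ m) :
    Integrable (fun ω => (v ⬝ᵥ fun k => X k ω) ^ (2 * m)) P ∧
      ∫ ω, (v ⬝ᵥ fun k => X k ω) ^ (2 * m) ∂P ≤ (360 * m * K ^ 2) ^ m := by
  have hYm : Measurable fun ω => v ⬝ᵥ fun k => X k ω := by
    unfold dotProduct
    exact Finset.measurable_fun_sum _ fun k _ => (hX k).const_mul _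
  have hYb : ∀ᵐ ω ∂P, |v ⬝ᵥ fun k => X k ω| ≤ ∑ k, |v k| * M := by
    have hall : ∀ᵐ ω ∂P, ∀ k, |X k ω| ≤ M := ae_all_iff.mpr hM
    filter_upwards [hall] with ω hω
    refine (Finset.abs_sum_le_sum_abs _ _).trans (Finset.sum_le_sum fun k _ => ?_)
    rw [abs_mul]
    exact mul_le_mul_of_nonneg_left (hω k) (abs_nonneg _)
  refine ⟨integrable_comp_of_ae_abs_le hYm hYb (φ := fun x => x ^ (2 * m)) (by fun_prop), ?_⟩
  -- The generating function bound needs a positive constant, while `K` may be zero in the noiseless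
  -- case. The estimate is proved for every `K' > K` and passes to the limit.
  have hpos : ∀ K' : ℝ, K < K' →
      ∫ ω, (v ⬝ᵥ fun k => X k ω) ^ (2 * m) ∂P ≤ (360 * m * K' ^ 2) ^ m := by
    intro K' hK'
    have hK'0 : 0 < K' := hK.trans_lt hK'
    refine integral_pow_le_of_mgf_le hYm hYb hK'0 (fun t => ?_) hm
    have hsc : iIndepFun (fun k ω => v k * X k ω) P :=
      hind.comp (fun k x => v k * x) fun k => measurable_const_mul (v k)
    have hfun : (fun ω => v ⬝ᵥ fun k => X k ω) = ∑ k, fun ω => v k * X k ω := by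
      ext ω
      simp [dotProduct]
    rw [hfun, hsc.mgf_sum (fun k => (hX k).const_mul _)]
    have hk : ∀ k ∈ Finset.univ, mgf (fun ω => v k * X k ω) P t
        ≤ Real.exp (15 * K' ^ 2 * (v k * t) ^ 2) := by
      intro k _
      have h := mgf_le_of_moments (hX k) (hM k) (h0 k) hK'0 (fun m hm => (hmom k m hm).trans
        (by gcongr)) (v k * t)
      refine le_trans (le_of_eq ?_) h
      unfold mgf
      congr 1
      ext ω
      ring_nf
    refine (Finset.prod_le_prod (fun k _ => mgf_nonneg) hk).trans (le_of_eq ?_)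
    rw [← Real.exp_sum]
    congr 1
    have : ∀ k, 15 * K' ^ 2 * (v k * t) ^ 2 = 15 * K' ^ 2 * t ^ 2 * (v k * v k) := by
      intro k; ring
    simp only [this, ← Finset.mul_sum]
    have hv' : ∑ k, v k * v k = 1 := hv
    rw [hv', mul_one]
  have hlim : Filter.Tendsto (fun K' : ℝ => (360 * m * K' ^ 2) ^ m) (nhdsWithin K (Set.Ioi K))
      (nhds ((360 * m * K ^ 2) ^ m)) :=
    (Continuous.tendsto (by fun_prop) K).mono_left nhdsWithin_le_nhds
  exact ge_of_tendsto hlim (Filter.eventually_of_mem self_mem_nhdsWithin hpos)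

/-- A sum of squares of variables with subgaussian moments is of the order of the number of
terms times the logarithm of the confidence level. -/
theorem withProbAtLeast_sum_sq_le {κ : Type*} [Fintype κ] [IsProbabilityMeasure P] {Y : κ → Ω → ℝ}
    (hY : ∀ r, Measurable (Y r)) {K : ℝ} {δ : ℝ} (hδ : 0 < δ)
    (hδ1 : 1 ≤ Real.log (1 / δ))
    (hint : ∀ r, ∀ m : ℕ, 1 ≤ m → Integrable (fun ω => Y r ω ^ (2 * m)) P)
    (hmom : ∀ r, ∀ m : ℕ, 1 ≤ m → ∫ ω, Y r ω ^ (2 * m) ∂P ≤ (360 * m * K ^ 2) ^ m) :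
    WithProbAtLeast P (1 - δ) fun ω =>
      ∑ r, Y r ω ^ 2 ≤ 2160 * Fintype.card κ * K ^ 2 * Real.log (1 / δ) := by
  -- This moment order makes `exp (-m) ≤ δ`. Since the logarithm is at least `1`, rounding up at
  -- most doubles it.
  set m := ⌈Real.log (1 / δ)⌉₊ with hmdef
  have hmlog : Real.log (1 / δ) ≤ m := Nat.le_ceil _
  have hm1 : 1 ≤ m := by
    have : (1 : ℝ) ≤ m := hδ1.trans hmlog
    exact_mod_cast this
  have hm2 : (m : ℝ) ≤ 2 * Real.log (1 / δ) := by
    have := Nat.ceil_lt_add_one (a := Real.log (1 / δ)) (by linarith)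
    linarith
  set J : ℝ := (Fintype.card κ : ℝ) with hJ
  have hJ0 : 0 ≤ J := by positivity
  set N : Ω → ℝ := fun ω => ∑ r, Y r ω ^ 2 with hN
  have hNm : Measurable N := Finset.measurable_fun_sum _ fun r _ => (hY r).pow_const 2
  have hN0 : ∀ ω, 0 ≤ N ω := fun ω => Finset.sum_nonneg fun r _ => sq_nonneg _
  -- The power mean inequality uses each `Y r` separately, so no joint law of the family is needed.
  have hpow : ∀ ω, N ω ^ m ≤ J ^ (m - 1) * ∑ r, Y r ω ^ (2 * m) := by
    intro ω
    have h := pow_sum_le_card_mul_sum_pow (s := Finset.univ) (f := fun r => Y r ω ^ 2)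
      (fun r _ => sq_nonneg _) (m - 1)
    rw [Nat.sub_add_cancel hm1] at h
    simpa only [← pow_mul, Finset.card_univ] using h
  have hintS : Integrable (fun ω => J ^ (m - 1) * ∑ r, Y r ω ^ (2 * m)) P :=
    (integrable_finsetSum _ fun r _ => hint r m hm1).const_mul _
  have hintN : Integrable (fun ω => N ω ^ m) P := by
    refine hintS.mono' (hNm.pow_const m).aestronglyMeasurable (Filter.Eventually.of_forall fun ω => ?_)
    rw [Real.norm_of_nonneg (pow_nonneg (hN0 ω) m)]
    exact hpow ω
  have hEN : ∫ ω, N ω ^ m ∂P ≤ (360 * J * m * K ^ 2) ^ m := by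
    calc ∫ ω, N ω ^ m ∂P ≤ ∫ ω, J ^ (m - 1) * ∑ r, Y r ω ^ (2 * m) ∂P :=
          integral_mono hintN hintS hpow
      _ = J ^ (m - 1) * ∑ r, ∫ ω, Y r ω ^ (2 * m) ∂P := by
          rw [integral_const_mul, integral_finsetSum _ fun r _ => hint r m hm1]
      _ ≤ J ^ (m - 1) * ∑ _r : κ, (360 * m * K ^ 2) ^ m := by
          gcongr with r
          exact hmom r m hm1
      _ = J ^ (m - 1) * J * (360 * m * K ^ 2) ^ m := by
          rw [Finset.sum_const, nsmul_eq_mul, Finset.card_univ]; ring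
      _ = _ := by
          rw [← pow_succ, Nat.sub_add_cancel hm1, ← mul_pow]; ring
  -- Three times the base of the moment bound, so Markov's inequality leaves `3 ^ (-m) ≤ exp (-m) ≤
  -- δ`. When `t = 0` there is nothing to divide by, but the moment vanishes and `N` is zero almost
  -- surely.
  set t := 3 * (360 * J * m * K ^ 2) with ht
  have ht0 : 0 ≤ t := by positivity
  refine ⟨{ω | N ω ≤ t}, measurableSet_le hNm measurable_const, ?_, ?_⟩
  · have hcompl : P.real {ω | N ω ≤ t}ᶜ ≤ δ := by
      rcases ht0.eq_or_lt with h0 | h0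
      · have hz : ∫ ω, N ω ^ m ∂P = 0 := by
          refine le_antisymm ?_ (integral_nonneg fun ω => pow_nonneg (hN0 ω) m)
          have : 360 * J * m * K ^ 2 = 0 := by linarith
          rwa [this, zero_pow (by omega)] at hEN
        rw [integral_eq_zero_iff_of_nonneg (fun ω => pow_nonneg (hN0 ω) m) hintN] at hz
        have : P {ω | N ω ≤ t}ᶜ = 0 := by
          change ∀ᵐ ω ∂P, N ω ≤ t
          filter_upwards [hz] with ω hω
          have : N ω = 0 := eq_zero_of_pow_eq_zero hω
          rw [this, ← h0]
        rw [measureReal_def, this]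
        simpa using hδ.le
      · have hmk := mul_meas_ge_le_integral_of_nonneg
          (Filter.Eventually.of_forall fun ω => pow_nonneg (hN0 ω) m) hintN (t ^ m)
        have hsub : P.real {ω | N ω ≤ t}ᶜ ≤ P.real {ω | t ^ m ≤ N ω ^ m} := by
          refine measureReal_mono fun ω hω => ?_
          simp only [Set.mem_compl_iff, Set.mem_ofPred_eq, not_le] at hω ⊢
          exact pow_le_pow_left₀ ht0 hω.le m
        have htm : 0 < t ^ m := by positivity
        have h3 : (3 : ℝ)⁻¹ ^ m ≤ δ := by
          have he : Real.exp (-(m : ℝ)) ≤ δ := by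
            rw [← Real.exp_log hδ]
            refine Real.exp_le_exp.mpr ?_
            rw [one_div, Real.log_inv] at hmlog
            linarith
          refine le_trans ?_ he
          rw [Real.exp_neg, ← Real.exp_one_pow, ← inv_pow]
          exact pow_le_pow_left₀ (by norm_num)
            (inv_anti₀ (Real.exp_pos 1) exp_one_le_three) m
        have h4 : t ^ m * P.real {ω | t ^ m ≤ N ω ^ m} ≤ t ^ m * (3 : ℝ)⁻¹ ^ m := by
          refine (hmk.trans hEN).trans (le_of_eq ?_)
          rw [← mul_pow, ht]
          congr 1
          ring
        exact hsub.trans ((le_of_mul_le_mul_left h4 htm).trans h3)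
    have := probReal_compl_eq_one_sub (μ := P) (measurableSet_le hNm (measurable_const (a := t)))
    linarith
  · intro ω hω
    refine le_trans hω ?_
    rw [ht]
    have : 0 ≤ J * K ^ 2 := by positivity
    nlinarith

end Moments

/-! ### The subgaussian norm of a centered Bernoulli variable -/

section Bernoulli

theorem integral_bernoulliLaw {q : ℝ} (hq0 : 0 ≤ q) (hq1 : q ≤ 1) (φ : ℝ → ℝ) :
    ∫ x, φ x ∂(bernoulliLaw q) = q * φ 1 + (1 - q) * φ 0 := by
  unfold bernoulliLaw
  have hd : ∀ a : ℝ, Integrable φ (Measure.dirac a) := fun a => integrable_dirac (by simp)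
  rw [integral_add_measure ((hd 1).smul_measure ENNReal.ofReal_ne_top)
    ((hd 0).smul_measure ENNReal.ofReal_ne_top), integral_smul_measure, integral_smul_measure,
    integral_dirac, integral_dirac, ENNReal.toReal_ofReal hq0,
    ENNReal.toReal_ofReal (by linarith), smul_eq_mul, smul_eq_mul]

theorem integral_bernoulliLaw_abs_rpow {q : ℝ} (hq0 : 0 ≤ q) (hq1 : q ≤ 1) (r : ℝ) :
    ∫ x, |x - q| ^ r ∂(bernoulliLaw q) = q * (1 - q) ^ r + (1 - q) * q ^ r := by
  rw [integral_bernoulliLaw hq0 hq1 (fun x => |x - q| ^ r), abs_of_nonneg (by linarith), zero_sub,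
    abs_neg, abs_of_nonneg hq0]

theorem bernoulliNorm_term_le_one {q : ℝ} (hq0 : 0 ≤ q) (hq1 : q ≤ 1) {r : ℝ} (hr : 1 ≤ r) :
    r ^ (-(1 / 2) : ℝ) * (∫ x, |x - q| ^ r ∂(bernoulliLaw q)) ^ (1 / r) ≤ 1 := by
  rw [integral_bernoulliLaw_abs_rpow hq0 hq1]
  have h1 : (1 - q) ^ r ≤ 1 := Real.rpow_le_one (by linarith) (by linarith) (by linarith)
  have h2 : q ^ r ≤ 1 := Real.rpow_le_one hq0 hq1 (by linarith)
  have h3 : 0 ≤ (1 - q) ^ r := Real.rpow_nonneg (by linarith) _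
  have h4 : 0 ≤ q ^ r := Real.rpow_nonneg hq0 _
  have h5 : 0 ≤ q * (1 - q) ^ r + (1 - q) * q ^ r :=
    add_nonneg (mul_nonneg hq0 h3) (mul_nonneg (by linarith) h4)
  have h6 : q * (1 - q) ^ r + (1 - q) * q ^ r ≤ 1 := by nlinarith
  refine mul_le_one₀ ?_ (Real.rpow_nonneg h5 _) (Real.rpow_le_one h5 h6 (by positivity))
  exact Real.rpow_le_one_of_one_le_of_nonpos hr (by norm_num)

/-- A real supremum of an unbounded family is `0` by convention, so boundedness is what makes each
term a lower bound for `bernoulliNorm`. -/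
theorem bddAbove_bernoulliNorm {q : ℝ} (hq0 : 0 ≤ q) (hq1 : q ≤ 1) :
    BddAbove (Set.range fun r : Set.Ici (1 : ℝ) => (r : ℝ) ^ (-(1 / 2) : ℝ) *
      (∫ x, |x - q| ^ (r : ℝ) ∂(bernoulliLaw q)) ^ (1 / (r : ℝ))) := by
  refine ⟨1, ?_⟩
  rintro _ ⟨r, rfl⟩
  exact bernoulliNorm_term_le_one hq0 hq1 r.2

theorem bernoulliNorm_nonneg (q : ℝ) : 0 ≤ bernoulliNorm q := by
  refine Real.iSup_nonneg fun r => ?_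
  have hr : (0 : ℝ) ≤ r := zero_le_one.trans r.2
  exact mul_nonneg (Real.rpow_nonneg hr _)
    (Real.rpow_nonneg (integral_nonneg fun x => Real.rpow_nonneg (abs_nonneg _) _) _)

theorem bernoulliNorm_le_one {q : ℝ} (hq0 : 0 ≤ q) (hq1 : q ≤ 1) : bernoulliNorm q ≤ 1 := by
  have : Nonempty (Set.Ici (1 : ℝ)) := ⟨⟨1, le_refl (1 : ℝ)⟩⟩
  exact ciSup_le fun r => bernoulliNorm_term_le_one hq0 hq1 r.2

/-- Even moments of a centered Bernoulli variable. -/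
theorem bernoulli_moment_le {q : ℝ} (hq0 : 0 ≤ q) (hq1 : q ≤ 1) {m : ℕ} (hm : 1 ≤ m) :
    q * (1 - q) ^ (2 * m) + (1 - q) * q ^ (2 * m) ≤ (bernoulliNorm q ^ 2 * (2 * m)) ^ m := by
  have hm0 : (1 : ℝ) ≤ m := by exact_mod_cast hm
  have hr : (1 : ℝ) ≤ ((2 * m : ℕ) : ℝ) := by push_cast; linarith
  -- The term `r = 2 * m` of the supremum, raised below to the power `2 * m`.
  have h := le_ciSup (bddAbove_bernoulliNorm hq0 hq1) ⟨((2 * m : ℕ) : ℝ), hr⟩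
  change _ ≤ bernoulliNorm q at h
  simp only at h
  rw [integral_bernoulliLaw_abs_rpow hq0 hq1, Real.rpow_natCast, Real.rpow_natCast] at h
  set I := q * (1 - q) ^ (2 * m) + (1 - q) * q ^ (2 * m) with hI
  have hI0 : 0 ≤ I := by
    have : 0 ≤ 1 - q := by linarith
    positivity
  have h2 := pow_le_pow_left₀ (by positivity) h (2 * m)
  rw [mul_pow, one_div ((2 * m : ℕ) : ℝ), Real.rpow_inv_natCast_pow hI0 (by omega), ← Real.rpow_natCast,
    ← Real.rpow_mul (by positivity)] at h2
  have h3 : (-(1 / 2) : ℝ) * ((2 * m : ℕ) : ℝ) = -(m : ℝ) := by push_cast; ring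
  rw [h3, Real.rpow_neg (by positivity), Real.rpow_natCast, inv_mul_le_iff₀ (by positivity)] at h2
  refine h2.trans (le_of_eq ?_)
  rw [pow_mul, ← mul_pow]
  push_cast
  ring

end Bernoulli

/-! ### One observation -/

section Entry

instance : IsProbabilityMeasure
    (ProbabilityTheory.cond (volume : Measure ℝ) (Set.Ico 0 (2 * Real.pi))) :=
  cond_isProbabilityMeasure_of_finite (by simp [Real.pi_pos])
    (by rw [Real.volume_Ico]; exact ENNReal.ofReal_ne_top)

theorem measurable_exp_mul_I : Measurable fun φ : ℝ => Complex.exp (φ * Complex.I) :=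
  Continuous.measurable (by fun_prop)

instance : IsProbabilityMeasure uniformCircle :=
  Measure.isProbabilityMeasure_map measurable_exp_mul_I.aemeasurable

theorem ae_norm_uniformCircle : ∀ᵐ u ∂uniformCircle, ‖u‖ = 1 := by
  unfold uniformCircle
  rw [ae_map_iff measurable_exp_mul_I.aemeasurable
    (measurableSet_eq_fun measurable_norm measurable_const)]
  exact Filter.Eventually.of_forall fun φ => Complex.norm_exp_ofReal_mul_I φ

theorem integral_uniformCircle {φ : ℂ → ℝ} (hφ : Continuous φ) :
    ∫ u, φ u ∂uniformCircle = (2 * Real.pi)⁻¹ *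
      ∫ x in (0 : ℝ)..(2 * Real.pi), φ (Complex.exp (x * Complex.I)) := by
  unfold uniformCircle
  rw [integral_map measurable_exp_mul_I.aemeasurable hφ.aestronglyMeasurable,
    ProbabilityTheory.cond, integral_smul_measure, integral_Ico_eq_integral_Ioc,
    intervalIntegral.integral_of_le (by positivity)]
  simp [Real.pi_pos.le]

theorem integral_re_uniformCircle : ∫ u, u.re ∂uniformCircle = 0 := by
  rw [integral_uniformCircle Complex.continuous_re]
  simp [Complex.exp_ofReal_mul_I_re]

theorem integral_im_uniformCircle : ∫ u, u.im ∂uniformCircle = 0 := by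
  rw [integral_uniformCircle Complex.continuous_im]
  simp [Complex.exp_ofReal_mul_I_im]

variable {η p : ℝ} {z : ℂ}

theorem integrable_uniformCircle {φ : ℂ → ℝ} (hφ : Continuous φ) : Integrable φ uniformCircle := by
  obtain ⟨C, hC⟩ := (isCompact_sphere (0 : ℂ) 1).exists_bound_of_continuousOn hφ.continuousOn
  refine Integrable.of_bound hφ.aestronglyMeasurable C ?_
  filter_upwards [ae_norm_uniformCircle] with u hu
  exact hC u (by simpa using hu)

theorem integral_entryLaw (hη0 : 0 ≤ η) (hη1 : η ≤ 1) (hp0 : 0 ≤ p) (hp1 : p ≤ 1) {φ : ℂ → ℝ}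
    (hφ : Continuous φ) :
    ∫ a, φ a ∂(entryLaw η p z)
      = (1 - η) * p * φ z + η * p * ∫ u, φ u ∂uniformCircle + (1 - p) * φ 0 := by
  unfold entryLaw
  have hd : ∀ a : ℂ, Integrable φ (Measure.dirac a) := fun a => integrable_dirac (by simp)
  have h1 := (hd z).smul_measure (ENNReal.ofReal_ne_top (r := (1 - η) * p))
  have h2 := (integrable_uniformCircle hφ).smul_measure (ENNReal.ofReal_ne_top (r := η * p))
  have h3 := (hd 0).smul_measure (ENNReal.ofReal_ne_top (r := 1 - p))
  rw [integral_add_measure (h1.add_measure h2) h3, integral_add_measure h1 h2]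
  simp only [integral_smul_measure, integral_dirac, smul_eq_mul]
  rw [ENNReal.toReal_ofReal (mul_nonneg (by linarith) hp0),
    ENNReal.toReal_ofReal (mul_nonneg hη0 hp0), ENNReal.toReal_ofReal (by linarith)]

theorem ae_norm_entryLaw_le (hz : ‖z‖ = 1) : ∀ᵐ a ∂(entryLaw η p z), ‖a‖ ≤ 1 := by
  unfold entryLaw
  rw [ae_add_measure_iff, ae_add_measure_iff]
  refine ⟨⟨?_, ?_⟩, ?_⟩
  · exact Measure.ae_smul_measure ((ae_dirac_iff (measurableSet_le measurable_norm
      measurable_const)).mpr hz.le) _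
  · exact Measure.ae_smul_measure (ae_norm_uniformCircle.mono fun u hu => hu.le) _
  · exact Measure.ae_smul_measure ((ae_dirac_iff (measurableSet_le measurable_norm
      measurable_const)).mpr (by simp)) _

/-- The three summands are the true, outlier and absent branches of one observation centered at `(1
- η) p z`. In the true branch the deviation is at most `(1 - p) + η`, and the `η` contribution is
why `Q` contains `η` itself. Each branch costs at most `16 ^ m * R`, and `3 * 16 ^ m ≤ 48 ^ m`. -/
theorem entry_moment_arith (hη0 : 0 ≤ η) (hη1 : η ≤ 1) (hp0 : 0 ≤ p) (hp1 : p ≤ 1) {m : ℕ}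
    {R : ℝ} (hpR : p * (1 - p) ^ (2 * m) + (1 - p) * p ^ (2 * m) ≤ R)
    (hηR : η * (1 - η) ^ (2 * m) + (1 - η) * η ^ (2 * m) ≤ R) (hR : η ^ (2 * m) ≤ R)
    (hm : 1 ≤ m) :
    (1 - η) * p * (1 - (1 - η) * p) ^ (2 * m) + η * p * 4 ^ m
      + (1 - p) * ((1 - η) * p) ^ (2 * m) ≤ 48 ^ m * R := by
  have hη' : 0 ≤ 1 - η := by linarith
  have hp' : 0 ≤ 1 - p := by linarith
  have hR0 : 0 ≤ R := (by positivity : (0 : ℝ) ≤ η ^ (2 * m)).trans hR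
  have h4 : (1 : ℝ) ≤ 4 ^ m := one_le_pow₀ (by norm_num)
  have hdp : (1 - η) * p ≤ p := by nlinarith
  have h1 : (1 - (1 - η) * p) ^ (2 * m) ≤ 4 ^ m * ((1 - p) ^ (2 * m) + η ^ (2 * m)) := by
    have h : 1 - (1 - η) * p ≤ (1 - p) + η := by nlinarith
    calc (1 - (1 - η) * p) ^ (2 * m) ≤ ((1 - p) + η) ^ (2 * m) :=
          pow_le_pow_left₀ (by nlinarith) h _
      _ ≤ 2 ^ (2 * m - 1) * ((1 - p) ^ (2 * m) + η ^ (2 * m)) := add_pow_le hp' hη0 _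
      _ ≤ 2 ^ (2 * m) * ((1 - p) ^ (2 * m) + η ^ (2 * m)) := by
          gcongr
          · norm_num
          · omega
      _ = _ := by rw [pow_mul]; norm_num
  have hT1 : (1 - η) * p * (1 - (1 - η) * p) ^ (2 * m)
      ≤ 4 ^ m * (p * (1 - p) ^ (2 * m)) + 4 ^ m * R := by
    calc (1 - η) * p * (1 - (1 - η) * p) ^ (2 * m)
        ≤ p * (4 ^ m * ((1 - p) ^ (2 * m) + η ^ (2 * m))) :=
          mul_le_mul hdp h1 (pow_nonneg (by nlinarith) _) hp0
      _ = 4 ^ m * (p * (1 - p) ^ (2 * m)) + p * (4 ^ m * η ^ (2 * m)) := by ring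
      _ ≤ 4 ^ m * (p * (1 - p) ^ (2 * m)) + 1 * (4 ^ m * R) := by gcongr
      _ = _ := by ring
  have hT3 : (1 - p) * ((1 - η) * p) ^ (2 * m) ≤ 4 ^ m * ((1 - p) * p ^ (2 * m)) := by
    calc (1 - p) * ((1 - η) * p) ^ (2 * m) ≤ 1 * ((1 - p) * p ^ (2 * m)) := by
          rw [one_mul]; gcongr
      _ ≤ _ := by gcongr
  -- The outlier branch carries the weight `η`. For `η ≤ 1/2` the Bernoulli moment contains `η (1 -
  -- η)^(2m) ≥ η / 4^m`; otherwise `η^(2m)` alone is at least `4^(-m)`.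
  have hηle : η ≤ 4 ^ m * R := by
    rcases le_or_gt η (1 / 2) with h | h
    · have h5 : (1 : ℝ) ≤ 4 ^ m * (1 - η) ^ (2 * m) := by
        rw [pow_mul, ← mul_pow]
        exact one_le_pow₀ (by nlinarith)
      calc η = η * 1 := by ring
        _ ≤ η * (4 ^ m * (1 - η) ^ (2 * m)) := by gcongr
        _ = 4 ^ m * (η * (1 - η) ^ (2 * m)) := by ring
        _ ≤ 4 ^ m * R := by
            gcongr
            have : 0 ≤ (1 - η) * η ^ (2 * m) := by positivity
            linarith
    · calc η ≤ 1 := hη1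
        _ ≤ (4 * η ^ 2) ^ m := one_le_pow₀ (by nlinarith)
        _ = 4 ^ m * η ^ (2 * m) := by rw [mul_pow, ← pow_mul]
        _ ≤ _ := by gcongr
  have hT2 : η * p * 4 ^ m ≤ 16 ^ m * R := by
    calc η * p * 4 ^ m ≤ η * 1 * 4 ^ m := by gcongr
      _ ≤ 4 ^ m * R * 1 * 4 ^ m := by gcongr
      _ = (4 * 4) ^ m * R := by rw [mul_pow]; ring
      _ = _ := by norm_num
  have h416 : (4 : ℝ) ^ m * R ≤ 16 ^ m * R := by gcongr; norm_num
  have h3 : (3 : ℝ) ≤ 3 ^ m := by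
    calc (3 : ℝ) = 3 ^ 1 := by norm_num
      _ ≤ 3 ^ m := pow_le_pow_right₀ (by norm_num) hm
  have hpR4 : 4 ^ m * (p * (1 - p) ^ (2 * m)) + 4 ^ m * ((1 - p) * p ^ (2 * m)) ≤ 4 ^ m * R := by
    rw [← mul_add]; gcongr
  calc _ ≤ 3 * (16 ^ m * R) := by linarith
    _ ≤ 3 ^ m * (16 ^ m * R) := by gcongr
    _ = 48 ^ m * R := by rw [← mul_assoc, ← mul_pow]; norm_num

/-- A real coordinate of a centered observation is centered. -/
theorem integral_entryLaw_sub (hη0 : 0 ≤ η) (hη1 : η ≤ 1) (hp0 : 0 ≤ p) (hp1 : p ≤ 1)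
    {l : ℂ →L[ℝ] ℝ} (hl : ∫ u, l u ∂uniformCircle = 0) :
    ∫ a, l (a - (((1 - η) * p : ℝ) : ℂ) * z) ∂(entryLaw η p z) = 0 := by
  rw [integral_entryLaw hη0 hη1 hp0 hp1 (by fun_prop)]
  have h1 : ∀ x : ℂ, l (x - (((1 - η) * p : ℝ) : ℂ) * z) = l x - (1 - η) * p * l z := by
    intro x
    rw [map_sub, ← Complex.real_smul, map_smul, smul_eq_mul]
  simp only [h1]
  rw [integral_sub (integrable_uniformCircle l.continuous) (integrable_const _), hl]
  simp
  ring

/-- Even moments of a real coordinate of a centered observation. -/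
theorem integral_entryLaw_sub_pow_le (hη0 : 0 ≤ η) (hη1 : η ≤ 1) (hp0 : 0 ≤ p) (hp1 : p ≤ 1)
    (hz : ‖z‖ = 1) {l : ℂ →L[ℝ] ℝ} (hl : ∀ x, |l x| ≤ ‖x‖) {Q : ℝ} (hηQ : η ≤ Q)
    (hnη : bernoulliNorm η ≤ Q) (hnp : bernoulliNorm p ≤ Q) {m : ℕ} (hm : 1 ≤ m) :
    ∫ a, l (a - (((1 - η) * p : ℝ) : ℂ) * z) ^ (2 * m) ∂(entryLaw η p z)
      ≤ (48 * Q ^ 2 * (2 * m)) ^ m := by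
  have hm1 : (1 : ℝ) ≤ m := by exact_mod_cast hm
  have hd0 : 0 ≤ (1 - η) * p := mul_nonneg (by linarith) hp0
  have hd1 : (1 - η) * p ≤ 1 := by nlinarith
  have hpow : ∀ (x : ℂ) (B : ℝ), ‖x‖ ≤ B → l x ^ (2 * m) ≤ B ^ (2 * m) := by
    intro x B hB
    rw [pow_mul, ← sq_abs, ← pow_mul]
    exact pow_le_pow_left₀ (abs_nonneg _) ((hl x).trans hB) _
  have hnd : ‖(((1 - η) * p : ℝ) : ℂ) * z‖ = (1 - η) * p := by
    rw [norm_mul, hz, mul_one, Complex.norm_real, Real.norm_of_nonneg hd0]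
  rw [integral_entryLaw hη0 hη1 hp0 hp1
    (φ := fun a => l (a - (((1 - η) * p : ℝ) : ℂ) * z) ^ (2 * m)) (by fun_prop)]
  have h1 : l (z - (((1 - η) * p : ℝ) : ℂ) * z) ^ (2 * m) ≤ (1 - (1 - η) * p) ^ (2 * m) := by
    refine hpow _ _ (le_of_eq ?_)
    have : z - (((1 - η) * p : ℝ) : ℂ) * z = ((1 - (1 - η) * p : ℝ) : ℂ) * z := by
      push_cast; ring
    rw [this, norm_mul, hz, mul_one, Complex.norm_real, Real.norm_of_nonneg (by linarith)]
  have h2 : ∫ u, l (u - (((1 - η) * p : ℝ) : ℂ) * z) ^ (2 * m) ∂uniformCircle ≤ 4 ^ m := by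
    have hae : ∀ᵐ u ∂uniformCircle, l (u - (((1 - η) * p : ℝ) : ℂ) * z) ^ (2 * m) ≤ 4 ^ m := by
      filter_upwards [ae_norm_uniformCircle] with u hu
      refine (hpow _ 2 ?_).trans (le_of_eq (by rw [pow_mul]; norm_num))
      refine (norm_sub_le _ _).trans ?_
      rw [hu, hnd]; linarith
    refine (integral_mono_ae (integrable_uniformCircle (φ := fun u =>
      l (u - (((1 - η) * p : ℝ) : ℂ) * z) ^ (2 * m)) (by fun_prop))
      (integrable_const _) hae).trans (by simp)
  have h3 : l (0 - (((1 - η) * p : ℝ) : ℂ) * z) ^ (2 * m) ≤ ((1 - η) * p) ^ (2 * m) :=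
    hpow _ _ (by rw [zero_sub, norm_neg, hnd])
  have hmono : ∀ x : ℝ, 0 ≤ x → x ≤ Q → (x ^ 2 * (2 * m)) ^ m ≤ (Q ^ 2 * (2 * m)) ^ m := by
    intro x hx hxQ
    gcongr
  have harith := entry_moment_arith (m := m) hη0 hη1 hp0 hp1
    ((bernoulli_moment_le hp0 hp1 hm).trans (hmono _ (bernoulliNorm_nonneg _) hnp))
    ((bernoulli_moment_le hη0 hη1 hm).trans (hmono _ (bernoulliNorm_nonneg _) hnη))
    (by
      refine le_trans ?_ (hmono η hη0 hηQ)
      rw [pow_mul]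
      exact pow_le_pow_left₀ (sq_nonneg _) (le_mul_of_one_le_right (sq_nonneg _) (by linarith)) _) hm
  calc _ ≤ (1 - η) * p * (1 - (1 - η) * p) ^ (2 * m) + η * p * 4 ^ m
      + (1 - p) * ((1 - η) * p) ^ (2 * m) := by
        have : 0 ≤ 1 - p := by linarith
        have : 0 ≤ η * p := mul_nonneg hη0 hp0
        gcongr
    _ ≤ _ := harith
    _ = _ := by rw [← mul_pow]; ring

end Entry

/-! ### The projected noise -/

section Noise

variable {n T : ℕ} {Ω : Type*} [MeasurableSpace Ω] {P : Measure Ω} {η : ℝ} {p : Fin T → ℝ}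
  {g : Fin T → Fin n → ℂ} {A : Ω → Fin T → Matrix (Fin n) (Fin n) ℂ}

theorem dMat_mul_gBar_apply (k : Fin T) (i j : Fin n) :
    (dMat n η p * gBar g) (k, i) j
      = (((1 - η) * p k : ℝ) : ℂ) * (g k i * star (g k j) - if i = j then 1 else 0) := by
  simp only [dMat, gBar, stack, Matrix.diagonal_mul, Matrix.sub_apply, Matrix.vecMulVec_apply,
    Pi.star_apply, Matrix.one_apply]

theorem card_lowFreq_index_le (τ : ℕ) : Fintype.card {l : Fin T // T ≤ l.val + τ} ≤ τ := by
  have h : Function.Injective fun l : {l : Fin T // T ≤ l.val + τ} =>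
      (⟨T - 1 - l.1.val, by have := l.1.isLt; have := l.2; omega⟩ : Fin τ) := by
    intro a b hab
    simp only [Fin.mk.injEq] at hab
    ext
    have := a.1.isLt
    have := b.1.isLt
    omega
  simpa using Fintype.card_le_of_injective _ h

/-- Even moments of the frequency components of the centered observations. -/
theorem IsOutliersModel.integral_dotProduct_pow_le [IsProbabilityMeasure P]
    (hA : IsOutliersModel P η p g A) (hη0 : 0 ≤ η) (hη1 : η ≤ 1) (hp0 : ∀ k, 0 ≤ p k)
    (hp1 : ∀ k, p k ≤ 1) (hg : ∀ k i, ‖g k i‖ = 1) {Q : ℝ} (hηQ : η ≤ Q)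
    (hnη : bernoulliNorm η ≤ Q) (hnp : ∀ k, bernoulliNorm (p k) ≤ Q)
    {l : ℂ →L[ℝ] ℝ} (hl : ∀ x, |l x| ≤ ‖x‖) (hl0 : ∫ u, l u ∂uniformCircle = 0)
    (hstar : ∃ c : ℝ, c ^ 2 = 1 ∧ ∀ x, l (star x) = c * l x)
    {w : Fin T → ℝ} (hw : w ⬝ᵥ w = 1) (i j : Fin n) {m : ℕ} (hm : 1 ≤ m) :
    Integrable (fun ω => (w ⬝ᵥ fun k =>
      l ((stack (A ω) - dMat n η p * gBar g) (k, i) j)) ^ (2 * m)) P ∧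
    ∫ ω, (w ⬝ᵥ fun k => l ((stack (A ω) - dMat n η p * gBar g) (k, i) j)) ^ (2 * m) ∂P
      ≤ (360 * m * (48 * Q ^ 2)) ^ m := by
  have hQ0 : 0 ≤ Q := hη0.trans hηQ
  -- entries above the diagonal
  have hlt : ∀ i j : Fin n, i < j → Integrable (fun ω => (w ⬝ᵥ fun k =>
      l ((stack (A ω) - dMat n η p * gBar g) (k, i) j)) ^ (2 * m)) P ∧
    ∫ ω, (w ⬝ᵥ fun k => l ((stack (A ω) - dMat n η p * gBar g) (k, i) j)) ^ (2 * m) ∂P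
      ≤ (360 * m * (48 * Q ^ 2)) ^ m := by
    intro i j hij
    have hz : ∀ k, ‖g k i * star (g k j)‖ = 1 := by
      intro k; rw [norm_mul, norm_star, hg, hg, one_mul]
    have heq : ∀ ω k, (stack (A ω) - dMat n η p * gBar g) (k, i) j
        = A ω k i j - (((1 - η) * p k : ℝ) : ℂ) * (g k i * star (g k j)) := by
      intro ω k
      rw [Matrix.sub_apply, dMat_mul_gBar_apply, if_neg hij.ne, sub_zero]
      rfl
    simp only [heq]
    have hsq : Real.sqrt (48 * Q ^ 2) ^ 2 = 48 * Q ^ 2 := Real.sq_sqrt (by positivity)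
    rw [← hsq]
    have hmeas : ∀ k, Measurable fun a : ℂ =>
        l (a - (((1 - η) * p k : ℝ) : ℂ) * (g k i * star (g k j))) :=
      fun k => Continuous.measurable (by fun_prop)
    have htr : ∀ (k : Fin T) (φ : ℂ → ℝ), Continuous φ →
        ∫ ω, φ (A ω k i j) ∂P = ∫ a, φ a ∂(entryLaw η (p k) (g k i * star (g k j))) := by
      intro k φ hφ
      rw [← hA.law k i j hij, integral_map (hA.measurable k i j).aemeasurable
        hφ.aestronglyMeasurable]
    refine DynSync.integral_dotProduct_pow_le
      (X := fun k ω => l (A ω k i j - (((1 - η) * p k : ℝ) : ℂ) * (g k i * star (g k j))))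
      (M := 2) ?_ (fun k => (hmeas k).comp (hA.measurable k i j)) ?_ ?_
      (Real.sqrt_nonneg _) ?_ hw hm
    -- For a fixed pair `i < j` the entries at different times are distinct members of the
    -- independent family.
    · have hsub := hA.indep.precomp
        (g := fun k : Fin T => (⟨(k, i, j), hij⟩ : {e : Fin T × Fin n × Fin n // e.2.1 < e.2.2}))
        (fun a b hab => by simpa using hab)
      exact hsub.comp _ hmeas
    · intro k
      have hae := ae_norm_entryLaw_le (η := η) (p := p k) (hz k)
      rw [← hA.law k i j hij] at hae
      filter_upwards [ae_of_ae_map (hA.measurable k i j).aemeasurable hae] with ω hω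
      refine (hl _).trans ((norm_sub_le _ _).trans ?_)
      rw [norm_mul, hz, mul_one, Complex.norm_real,
        Real.norm_of_nonneg (mul_nonneg (by linarith) (hp0 k))]
      have := hp0 k
      have := hp1 k
      nlinarith
    · intro k
      rw [htr k (fun a => l (a - (((1 - η) * p k : ℝ) : ℂ) * (g k i * star (g k j))))
        (by fun_prop)]
      exact integral_entryLaw_sub hη0 hη1 (hp0 k) (hp1 k) hl0
    · intro k m hm
      rw [htr k (fun a => l (a - (((1 - η) * p k : ℝ) : ℂ) * (g k i * star (g k j))) ^ (2 * m))
        (by fun_prop), hsq]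
      exact integral_entryLaw_sub_pow_le hη0 hη1 (hp0 k) (hp1 k) (hz k) hl hηQ hnη (hnp k) hm
  rcases lt_trichotomy i j with hij | hij | hij
  · exact hlt i j hij
  · subst hij
    have h0 : ∀ ω k, (stack (A ω) - dMat n η p * gBar g) (k, i) i = 0 := by
      intro ω k
      rw [Matrix.sub_apply, dMat_mul_gBar_apply, if_pos rfl, RCLike.star_def, Complex.mul_conj',
        hg]
      simp [stack, hA.diag]
    have hm0 : 2 * m ≠ 0 := by omega
    simp only [h0, map_zero, dotProduct, mul_zero, Finset.sum_const_zero, zero_pow hm0]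
    exact ⟨integrable_zero _ _ _, by rw [integral_zero]; positivity⟩
  -- Below the diagonal the error is the conjugate of the one above. Conjugation changes a
  -- coordinate only by a sign, which even powers do not see.
  · obtain ⟨c, hc, hcl⟩ := hstar
    have hconj : ∀ ω k, (stack (A ω) - dMat n η p * gBar g) (k, i) j
        = star ((stack (A ω) - dMat n η p * gBar g) (k, j) i) := by
      intro ω k
      rw [Matrix.sub_apply, Matrix.sub_apply, dMat_mul_gBar_apply, dMat_mul_gBar_apply,
        if_neg hij.ne, if_neg hij.ne', star_sub]
      congr 1
      · exact ((hA.hermitian ω k).apply i j).symm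
      · simp only [sub_zero, star_mul', RCLike.star_def, Complex.conj_ofReal, Complex.conj_conj]
        ring
    have hY : ∀ ω, (w ⬝ᵥ fun k => l ((stack (A ω) - dMat n η p * gBar g) (k, i) j)) ^ (2 * m)
        = (w ⬝ᵥ fun k => l ((stack (A ω) - dMat n η p * gBar g) (k, j) i)) ^ (2 * m) := by
      intro ω
      have : (fun k => l ((stack (A ω) - dMat n η p * gBar g) (k, i) j))
          = c • fun k => l ((stack (A ω) - dMat n η p * gBar g) (k, j) i) := by
        ext k
        rw [hconj, hcl]; rfl
      rw [this, dotProduct_smul, smul_eq_mul, mul_pow, pow_mul c, hc, one_pow, one_mul]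
    simp only [hY]
    exact hlt j i hij

/-- The noise that survives the low-frequency projection. -/
theorem IsOutliersModel.withProbAtLeast_frobSq_proj_le [IsProbabilityMeasure P]
    (hA : IsOutliersModel P η p g A) (hη0 : 0 ≤ η) (hη1 : η ≤ 1) (hp0 : ∀ k, 0 ≤ p k)
    (hp1 : ∀ k, p k ≤ 1) (hg : ∀ k i, ‖g k i‖ = 1) {Q : ℝ} (hηQ : η ≤ Q)
    (hnη : bernoulliNorm η ≤ Q) (hnp : ∀ k, bernoulliNorm (p k) ≤ Q)
    {v : Fin T → Fin T → ℝ} (hv : IsPathEigenbasis v) (τ : ℕ) {δ : ℝ} (hδ : 0 < δ)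
    (hδ1 : 1 ≤ Real.log (1 / δ)) :
    WithProbAtLeast P (1 - δ) fun ω =>
      frobSq (proj n v τ * (stack (A ω) - dMat n η p * gBar g))
        ≤ 207360 * (n : ℝ) ^ 2 * τ * (Q ^ 2 * Real.log (1 / δ)) := by
  let l : Bool → ℂ →L[ℝ] ℝ := fun b => if b then Complex.reCLM else Complex.imCLM
  -- One variable per matrix entry, retained frequency and real or imaginary part, at most `2 n² τ`
  -- in all. The constant is `2160 * 48 * 2 = 207360`.
  let Y : (Fin n × Fin n) × {l : Fin T // T ≤ l.val + τ} × Bool → Ω → ℝ := fun r ω =>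
    v r.2.1.1 ⬝ᵥ fun k => l r.2.2 ((stack (A ω) - dMat n η p * gBar g) (k, r.1.1) r.1.2)
  have hsq : Real.sqrt (48 * Q ^ 2) ^ 2 = 48 * Q ^ 2 := Real.sq_sqrt (by positivity)
  have hmom : ∀ r, ∀ m : ℕ, 1 ≤ m → Integrable (fun ω => Y r ω ^ (2 * m)) P ∧
      ∫ ω, Y r ω ^ (2 * m) ∂P ≤ (360 * m * Real.sqrt (48 * Q ^ 2) ^ 2) ^ m := by
    rintro ⟨⟨i, j⟩, q, b⟩ m hm
    rw [hsq]
    refine hA.integral_dotProduct_pow_le hη0 hη1 hp0 hp1 hg hηQ hnη hnp (l := l b) ?_ ?_ ?_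
      (by rw [hv.orthonormal, if_pos rfl]) i j hm
    · intro x
      cases b
      · exact Complex.abs_im_le_norm x
      · exact Complex.abs_re_le_norm x
    · cases b
      · exact integral_im_uniformCircle
      · exact integral_re_uniformCircle
    · cases b
      · exact ⟨-1, by norm_num, fun x => by simp [l]⟩
      · exact ⟨1, by norm_num, fun x => by simp [l]⟩
  have hmeas : ∀ r, Measurable (Y r) := by
    intro r
    refine Finset.measurable_fun_sum _ fun k _ => Measurable.const_mul ?_ _
    refine (l r.2.2).continuous.measurable.comp ?_
    exact (hA.measurable k r.1.1 r.1.2).sub_const _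
  obtain ⟨E, hE, hPE, hgood⟩ := withProbAtLeast_sum_sq_le hmeas hδ hδ1
    (fun r m hm => (hmom r m hm).1) (fun r m hm => (hmom r m hm).2)
  refine ⟨E, hE, hPE, fun ω hω => ?_⟩
  have hsum : frobSq (proj n v τ * (stack (A ω) - dMat n η p * gBar g)) = ∑ r, Y r ω ^ 2 := by
    rw [hv.frobSq_proj_mul, Fintype.sum_prod_type, Fintype.sum_prod_type]
    refine Finset.sum_congr rfl fun i _ => Finset.sum_congr rfl fun j _ => ?_
    rw [Fintype.sum_prod_type, Finset.sum_subtype (p := fun q : Fin T => T ≤ q.val + τ) _ (by simp)]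
    refine Finset.sum_congr rfl fun q _ => ?_
    rw [Fintype.sum_bool]
    rfl
  refine hsum.trans_le ((hgood ω hω).trans ?_)
  rw [hsq]
  simp only [Fintype.card_prod, Fintype.card_fin, Fintype.card_bool]
  push_cast
  have hc : (Fintype.card {l : Fin T // T ≤ l.val + τ} : ℝ) ≤ τ := by
    exact_mod_cast card_lowFreq_index_le τ
  calc _ = 207360 * (n : ℝ) ^ 2 * (Fintype.card {l : Fin T // T ≤ l.val + τ} : ℝ)
        * (Q ^ 2 * Real.log (1 / δ)) := by ring
    _ ≤ _ := by gcongr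

end Noise

/-! ### Bounds for the parameters -/

section Parameters

variable {T : ℕ} {η : ℝ} {p : Fin T → ℝ}

theorem pMin_le (k : Fin T) : pMin p ≤ p k := ciInf_le (Set.finite_range _).bddBelow k

theorem le_pMin [NeZero T] {c : ℝ} (h : ∀ k, c ≤ p k) : c ≤ pMin p := le_ciInf h

theorem pMin_pos [NeZero T] (hp : ∀ k, 0 < p k) : 0 < pMin p := by
  obtain ⟨k, hk⟩ := exists_eq_ciInf_of_finite (f := p)
  rw [pMin, ← hk]
  exact hp k

theorem fNoise_nonneg (hη0 : 0 ≤ η) (hη1 : η ≤ 1) (hp0 : ∀ k, 0 ≤ p k) (hp1 : ∀ k, p k ≤ 1) :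
    0 ≤ fNoise η p := by
  have h1 : 0 ≤ pMax p := Real.iSup_nonneg hp0
  have h2 : 0 ≤ varMax p :=
    Real.iSup_nonneg fun k => mul_nonneg (hp0 k) (by linarith [hp1 k])
  have h3 : 0 ≤ 1 - η := by linarith
  unfold fNoise
  positivity

theorem fNoise_le_three [NeZero T] (hη0 : 0 ≤ η) (hη1 : η ≤ 1) (hp0 : ∀ k, 0 ≤ p k)
    (hp1 : ∀ k, p k ≤ 1) : fNoise η p ≤ 3 := by
  have h1 : 0 ≤ pMax p := Real.iSup_nonneg hp0
  have h1' : pMax p ≤ 1 := ciSup_le hp1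
  have h2 : 0 ≤ varMax p :=
    Real.iSup_nonneg fun k => mul_nonneg (hp0 k) (by linarith [hp1 k])
  have h2' : varMax p ≤ 1 := ciSup_le fun k => by nlinarith [hp0 k, hp1 k]
  have h3 : 0 ≤ 1 - η := by linarith
  have h3' : 1 - η ≤ 1 := by linarith
  have e1 : pMax p * η ≤ 1 := mul_le_one₀ h1' hη0 hη1
  have e2 : (1 - η) ^ 2 * varMax p ≤ 1 := mul_le_one₀ (pow_le_one₀ h3 h3') h2 h2'
  have e3 : pMax p * varMax p * (1 - η) ≤ 1 := mul_le_one₀ (mul_le_one₀ h1' h2 h2') h3 h3'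
  unfold fNoise
  linarith

theorem iSup_bernoulliNorm_nonneg : 0 ≤ ⨆ k, bernoulliNorm (p k) :=
  Real.iSup_nonneg fun _ => bernoulliNorm_nonneg _

theorem le_qNoise : η ≤ qNoise η p := by
  have h1 := bernoulliNorm_nonneg η
  have h2 := iSup_bernoulliNorm_nonneg (p := p)
  unfold qNoise
  linarith

theorem bernoulliNorm_le_qNoise (hη0 : 0 ≤ η) : bernoulliNorm η ≤ qNoise η p := by
  have h2 := iSup_bernoulliNorm_nonneg (p := p)
  unfold qNoise
  linarith

theorem bernoulliNorm_apply_le_qNoise (hη0 : 0 ≤ η) (k : Fin T) :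
    bernoulliNorm (p k) ≤ qNoise η p := by
  have h1 := bernoulliNorm_nonneg η
  have h2 : bernoulliNorm (p k) ≤ ⨆ k, bernoulliNorm (p k) :=
    le_ciSup (f := fun k => bernoulliNorm (p k)) (Set.finite_range _).bddAbove k
  unfold qNoise
  linarith

theorem qNoise_le_three [NeZero T] (hη0 : 0 ≤ η) (hη1 : η ≤ 1) (hp0 : ∀ k, 0 ≤ p k)
    (hp1 : ∀ k, p k ≤ 1) : qNoise η p ≤ 3 := by
  have h1 := bernoulliNorm_le_one hη0 hη1
  have h2 : ⨆ k, bernoulliNorm (p k) ≤ 1 := ciSup_le fun k => bernoulliNorm_le_one (hp0 k) (hp1 k)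
  unfold qNoise
  linarith

theorem dBar_le [NeZero T] {c : ℝ} (h : ∀ k, (1 - η) * p k ≤ c) : dBar η p ≤ c := by
  have hT : (0 : ℝ) < T := by exact_mod_cast Nat.pos_of_ne_zero (NeZero.ne T)
  unfold dBar
  rw [div_le_iff₀ hT]
  refine (Finset.sum_le_sum fun k _ => h k).trans (le_of_eq ?_)
  simp [mul_comm]

theorem le_dBar [NeZero T] {c : ℝ} (h : ∀ k, c ≤ (1 - η) * p k) : c ≤ dBar η p := by
  have hT : (0 : ℝ) < T := by exact_mod_cast Nat.pos_of_ne_zero (NeZero.ne T)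
  unfold dBar
  rw [le_div_iff₀ hT]
  refine le_trans (le_of_eq ?_) (Finset.sum_le_sum fun k _ => h k)
  simp [mul_comm]

end Parameters

/-! ### The error bounds -/

section Bounds

variable {n T : ℕ}

theorem frobSq_neg {ι κ : Type*} [Fintype ι] [Fintype κ] (X : Matrix ι κ ℂ) :
    frobSq (-X) = frobSq X := by
  simp [frobSq]

theorem frobSq_gHat_sub_le (v : Fin T → Fin T → ℝ) (τ : ℕ)
    (A : Fin T → Matrix (Fin n) (Fin n) ℂ) (X : Matrix (Fin T × Fin n) (Fin n) ℂ) :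
    frobSq (gHat v τ A - X) ≤ 2 * frobSq (proj n v τ * (stack A - X))
      + 2 * frobSq ((1 - proj n v τ) * X) := by
  have h : gHat v τ A - X = proj n v τ * (stack A - X) + -((1 - proj n v τ) * X) := by
    unfold gHat
    rw [Matrix.mul_sub, Matrix.sub_mul, Matrix.one_mul]
    abel
  rw [h]
  refine (frobSq_add_le _ _).trans ?_
  rw [frobSq_neg]

/-- The rate obtained from the optimal cut-off. -/
theorem bias_add_noise_le {F M N T S : ℝ} (hF : 0 < F) (hM : 0 < M) (hN : 0 < N) (hT : 0 < T)
    (hS : 0 < S)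
    (h : max ((N * F / (M * S)) ^ (1 / 2 : ℝ)) (M * S / (N * F)) ≤ T) :
    max (M * N * T ^ 2 * S / (1 + (M * T ^ 2 * S / (N * F)) ^ (2 / 3 : ℝ))) (M * N * S)
        + F * N ^ 2 * (1 + (M * T ^ 2 * S / (N * F)) ^ (1 / 3 : ℝ))
      ≤ 3 * (F ^ (2 / 3 : ℝ) * M ^ (1 / 3 : ℝ) * N ^ (5 / 3 : ℝ) * T ^ (2 / 3 : ℝ)
        * S ^ (1 / 3 : ℝ)) := by
  have hroot : ∀ x : ℝ, 0 < x → ∃ y, 0 < y ∧ x = y ^ 3 := fun x hx =>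
    ⟨x ^ (1 / 3 : ℝ), by positivity, by
      rw [← Real.rpow_natCast, ← Real.rpow_mul hx.le]; norm_num⟩
  have hpow : ∀ (y : ℝ), 0 < y → ∀ (r : ℝ) (m : ℕ), 3 * r = m → (y ^ 3) ^ r = y ^ m := by
    intro y hy r m hr
    rw [← Real.rpow_natCast y 3, ← Real.rpow_mul hy.le, ← Real.rpow_natCast y m, ← hr]
    norm_num
  -- The two halves of the condition on `T` amount to `1 ≤ ρ` and `ρ ≤ T ^ 3`, that is, to `1 ≤ y ≤
  -- T` for the cube root `y` of `ρ`.
  have h1 : N * F / (M * S) ≤ T ^ 2 := by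
    have h1 := pow_le_pow_left₀ (by positivity) ((le_max_left _ _).trans h) 2
    rwa [← Real.rpow_natCast, ← Real.rpow_mul (by positivity),
      show (1 / 2 : ℝ) * ((2 : ℕ) : ℝ) = 1 by norm_num, Real.rpow_one] at h1
  have h2 := (le_max_right _ _).trans h
  set ρ := M * T ^ 2 * S / (N * F) with hρ
  have hρ0 : 0 < ρ := by positivity
  have hρ1 : 1 ≤ ρ := by
    rw [div_le_iff₀ (by positivity)] at h1
    rw [hρ, le_div_iff₀ (by positivity)]
    linarith
  have hρT : ρ ≤ T ^ 3 := by
    have : ρ = M * S / (N * F) * T ^ 2 := by rw [hρ]; ring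
    rw [this]
    calc _ ≤ T * T ^ 2 := by gcongr
      _ = T ^ 3 := by ring
  obtain ⟨y, hy, hy3⟩ := hroot ρ hρ0
  have hyT : y ≤ T := le_of_pow_le_pow_left₀ (n := 3) (by norm_num) hT.le (by rwa [← hy3])
  have hy1 : 1 ≤ y := by
    refine le_of_pow_le_pow_left₀ (n := 3) (by norm_num) hy.le ?_
    rwa [one_pow, ← hy3]
  have hMN : M * N * T ^ 2 * S = F * N ^ 2 * y ^ 3 := by
    rw [← hy3, hρ]; field_simp
  -- Writing every parameter as a cube turns the fractional powers into monomials and reveals the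
  -- target rate as `F * N ^ 2 * y`.
  have hB : F ^ (2 / 3 : ℝ) * M ^ (1 / 3 : ℝ) * N ^ (5 / 3 : ℝ) * T ^ (2 / 3 : ℝ)
        * S ^ (1 / 3 : ℝ) = F * N ^ 2 * y := by
    obtain ⟨a, ha, rfl⟩ := hroot F hF
    obtain ⟨b, hb, rfl⟩ := hroot M hM
    obtain ⟨c, hc, rfl⟩ := hroot N hN
    obtain ⟨t, ht, rfl⟩ := hroot T hT
    obtain ⟨s, hs, rfl⟩ := hroot S hS
    have hyv : y = b * t ^ 2 * s / (c * a) := by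
      refine (pow_left_inj₀ hy.le (by positivity) (n := 3) (by norm_num)).mp ?_
      rw [← hy3, hρ]
      field_simp
    rw [hpow a ha _ 2 (by norm_num), hpow b hb _ 1 (by norm_num), hpow c hc _ 5 (by norm_num),
      hpow t ht _ 2 (by norm_num), hpow s hs _ 1 (by norm_num), hyv]
    field_simp
  rw [hB, hy3, hpow y hy _ 2 (by norm_num), hpow y hy _ 1 (by norm_num), hMN, pow_one]
  have hFN : 0 < F * N ^ 2 := by positivity
  have e1 : F * N ^ 2 * y ^ 3 / (1 + y ^ 2) ≤ F * N ^ 2 * y := by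
    rw [div_le_iff₀ (by positivity)]
    have : 0 < F * N ^ 2 * y := by positivity
    linarith
  have e2 : M * N * S ≤ F * N ^ 2 * y := by
    have hy2 : y ^ 2 ≤ T ^ 2 := by gcongr
    have : M * N * S * T ^ 2 ≤ F * N ^ 2 * y * T ^ 2 := by
      calc M * N * S * T ^ 2 = F * N ^ 2 * y * y ^ 2 := by linarith
        _ ≤ _ := by gcongr
    exact le_of_mul_le_mul_right this (by positivity)
  have e3 := max_le e1 e2
  have e4 : F * N ^ 2 * 1 ≤ F * N ^ 2 * y := by gcongr
  linarith

variable {Ω : Type u} [MeasurableSpace Ω] {P : Measure Ω}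
  {v : Fin T → Fin T → ℝ} {η : ℝ} {p : Fin T → ℝ} {g : Fin T → Fin n → ℂ} {S μ : ℝ}
  {A : Ω → Fin T → Matrix (Fin n) (Fin n) ℂ}

theorem one_le_tauStar [NeZero T] (δ : ℝ) : 1 ≤ tauStar n η p μ S δ := by
  have hT : 1 ≤ T := Nat.pos_of_ne_zero (NeZero.ne T)
  unfold tauStar
  split_ifs
  · exact hT
  · exact le_min (by omega) hT

theorem tauStar_le (δ : ℝ) : tauStar n η p μ S δ ≤ T := by
  unfold tauStar
  split_ifs
  · exact le_rfl
  · exact min_le_right _ _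

theorem qNoise_sq_mul_log_le_fTilde [NeZero n] (h : IsSetting P v η p g S μ A) (δ : ℝ) :
    qNoise η p ^ 2 * Real.log (1 / δ) ≤ fTilde η p δ := by
  have := fNoise_nonneg h.eta_nonneg h.eta_lt_one.le (fun k => (h.p_pos k).le) h.p_le_one
  unfold fTilde
  linarith

theorem fTilde_nonneg [NeZero n] (h : IsSetting P v η p g S μ A) {δ : ℝ} (hδ : 1 ≤ Real.log (1 / δ)) :
    0 ≤ fTilde η p δ :=
  le_trans (by positivity) (qNoise_sq_mul_log_le_fTilde h δ)

theorem le_fTilde [NeZero n] (h : IsSetting P v η p g S μ A) {δ : ℝ} (hδ : 1 ≤ Real.log (1 / δ)) :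
    η ^ 2 * Real.log (1 / δ) ≤ fTilde η p δ := by
  refine le_trans ?_ (qNoise_sq_mul_log_le_fTilde h δ)
  have := h.eta_nonneg
  gcongr
  exact le_qNoise

theorem ratio_nonneg [NeZero n] (h : IsSetting P v η p g S μ A) {δ : ℝ} (hδ : 1 ≤ Real.log (1 / δ)) :
    0 ≤ ratio n η p μ S δ := by
  have h1 := fTilde_nonneg h hδ
  have h2 := h.S_nonneg
  have h3 : 0 ≤ μ := zero_le_one.trans h.mu_ge_one
  unfold ratio
  positivity

variable [NeZero n] [NeZero T]

theorem dBar_pos (h : IsSetting P v η p g S μ A) : 0 < dBar η p := by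
  have h1 : 0 < (1 - η) * pMin p := mul_pos (by linarith [h.eta_lt_one]) (pMin_pos h.p_pos)
  refine h1.trans_le (le_dBar fun k => ?_)
  exact mul_le_mul_of_nonneg_left (pMin_le k) (by linarith [h.eta_lt_one])

theorem fTilde_mul_tauStar_le (h : IsSetting P v η p g S μ A) {δ : ℝ}
    (hδ : 1 ≤ Real.log (1 / δ)) :
    fTilde η p δ * (tauStar n η p μ S δ : ℝ)
      ≤ fTilde η p δ * min (1 + ratio n η p μ S δ ^ (1 / 3 : ℝ)) T := by
  have hρ := ratio_nonneg h hδ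
  by_cases h0 : fTilde η p δ = 0
  · simp [h0]
  · refine mul_le_mul_of_nonneg_left ?_ (fTilde_nonneg h hδ)
    rw [tauStar, if_neg h0, Nat.cast_min]
    refine min_le_min_right _ ?_
    push_cast
    have := Nat.floor_le (a := ratio n η p μ S δ ^ (1 / 3 : ℝ)) (by positivity)
    linarith

/-- When `τ* < T` the minimum is inactive, so `τ*` exceeds both `ρ^(1/3)` before rounding and `1`.
This converts the factor `1 / τ²` of the bias into the stated denominator. -/
theorem one_add_ratio_le_tauStar_sq (h : IsSetting P v η p g S μ A) {δ : ℝ}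
    (hδ : 1 ≤ Real.log (1 / δ)) (hlt : tauStar n η p μ S δ < T) :
    1 + ratio n η p μ S δ ^ (2 / 3 : ℝ) ≤ 2 * (tauStar n η p μ S δ : ℝ) ^ 2 := by
  have hρ := ratio_nonneg h hδ
  have h0 : fTilde η p δ ≠ 0 := by
    intro h0
    rw [tauStar, if_pos h0] at hlt
    exact lt_irrefl _ hlt
  have hτ : tauStar n η p μ S δ = 1 + ⌊ratio n η p μ S δ ^ (1 / 3 : ℝ)⌋₊ := by
    rw [tauStar, if_neg h0] at hlt ⊢
    omega
  set x := ratio n η p μ S δ ^ (1 / 3 : ℝ) with hx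
  have hx0 : 0 ≤ x := by positivity
  have hx2 : ratio n η p μ S δ ^ (2 / 3 : ℝ) = x ^ 2 := by
    rw [hx, ← Real.rpow_natCast, ← Real.rpow_mul hρ]; norm_num
  have h1 : x ≤ tauStar n η p μ S δ := by
    rw [hτ]; push_cast
    linarith [Nat.lt_floor_add_one x]
  have h2 : (1 : ℝ) ≤ tauStar n η p μ S δ := by exact_mod_cast one_le_tauStar δ
  rw [hx2]
  nlinarith

/-- The bias of the denoised matrix. -/
theorem frobSq_bias_le (h : IsSetting P v η p g S μ A) {δ : ℝ} (hδ : 1 ≤ Real.log (1 / δ)) :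
    frobSq ((1 - proj n v (tauStar n η p μ S δ)) * (dMat n η p * gBar g))
      ≤ 32 * (max (μ * dBar η p ^ 2 * n * (T : ℝ) ^ 2 * S
          / (1 + (ratio n η p μ S δ) ^ (2 / 3 : ℝ))) (μ * dBar η p ^ 2 * n * S)
        * (if tauStar n η p μ S δ < T then 1 else 0)) := by
  by_cases hlt : tauStar n η p μ S δ < T
  · rw [if_pos hlt, mul_one]
    set τ := tauStar n η p μ S δ
    have hτ1 : 1 ≤ τ := one_le_tauStar δ
    have hτ0 : (0 : ℝ) < τ := by exact_mod_cast hτ1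
    have hμ : 0 ≤ μ := zero_le_one.trans h.mu_ge_one
    have hS := h.S_nonneg
    have hρ := ratio_nonneg h hδ
    have hsm := h.d_smooth τ hτ1 hlt.le
    have hb := h.basis.sq_mul_frobSq_one_sub_proj_gBar_le hτ1 hlt h.truth.unit
    have hb2 : (τ : ℝ) ^ 2 * frobSq ((1 - proj n v τ) * gBar g)
        ≤ 16 * (T : ℝ) ^ 2 * n * S := by
      refine hb.trans ?_
      gcongr
      exact h.truth.smooth
    have hτρ := one_add_ratio_le_tauStar_sq h hδ hlt
    set r := ratio n η p μ S δ ^ (2 / 3 : ℝ)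
    have hr0 : 0 ≤ r := by positivity
    calc frobSq ((1 - proj n v τ) * (dMat n η p * gBar g))
        ≤ μ * dBar η p ^ 2 * frobSq ((1 - proj n v τ) * gBar g) := hsm
      _ ≤ μ * dBar η p ^ 2 * (32 * (T : ℝ) ^ 2 * n * S / (1 + r)) := by
          gcongr
          rw [le_div_iff₀ (by positivity)]
          have := frobSq_nonneg ((1 - proj n v τ) * gBar g)
          nlinarith
      _ = 32 * (μ * dBar η p ^ 2 * n * (T : ℝ) ^ 2 * S / (1 + r)) := by ring
      _ ≤ _ := by
          gcongr
          exact le_max_left _ _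
  -- At `τ* = T` all frequencies are kept and the bias vanishes, which is what the indicator
  -- records.
  · have hτ : tauStar n η p μ S δ = T := le_antisymm (tauStar_le δ) (not_lt.mp hlt)
    rw [if_neg hlt, hτ, h.basis.one_sub_proj_self, Matrix.zero_mul]
    simp [frobSq]

/-- The general error bound. -/
theorem withProbAtLeast_distSq_le (h : IsSetting P v η p g S μ A) {δ : ℝ} (hδ0 : 0 < δ)
    (hδ : 1 ≤ Real.log (1 / δ)) :
    WithProbAtLeast P (1 - δ) fun ω => ∀ gh : Fin T → Fin n → ℂ,
      IsOutput v (tauStar n η p μ S δ) (A ω) gh →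
        distSq gh g ≤ generalBound 6635520 n η p μ S δ := by
  have := h.prob
  obtain ⟨E, hE, hPE, hgood⟩ := h.model.withProbAtLeast_frobSq_proj_le h.eta_nonneg
    h.eta_lt_one.le (fun k => (h.p_pos k).le) h.p_le_one h.truth.unit (le_qNoise (p := p))
    (bernoulliNorm_le_qNoise h.eta_nonneg) (bernoulliNorm_apply_le_qNoise h.eta_nonneg) h.basis
    (tauStar n η p μ S δ) hδ0 hδ
  refine ⟨E, hE, hPE, fun ω hω gh hgh => ?_⟩
  have hη : 0 < 1 - η := by linarith [h.eta_lt_one]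
  have hpm := pMin_pos h.p_pos
  have hd : 0 < (1 - η) * pMin p := mul_pos hη hpm
  refine (distSq_le_frobSq v _ (A ω) h.truth.unit h.truth.anchor hgh hd fun k =>
    mul_le_mul_of_nonneg_left (pMin_le k) hη.le).trans ?_
  have hsplit := frobSq_gHat_sub_le v (tauStar n η p μ S δ) (A ω) (dMat n η p * gBar g)
  have hnoise := hgood ω hω
  simp only at hnoise
  have hbias := frobSq_bias_le h hδ
  have hf := qNoise_sq_mul_log_le_fTilde h δ
  have hfτ := fTilde_mul_tauStar_le h hδ
  have hnoise2 : frobSq (proj n v (tauStar n η p μ S δ) * (stack (A ω) - dMat n η p * gBar g))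
      ≤ 207360 * (fTilde η p δ * (n : ℝ) ^ 2
        * min (1 + ratio n η p μ S δ ^ (1 / 3 : ℝ)) T) := by
    calc _ ≤ _ := hnoise
      _ ≤ 207360 * (n : ℝ) ^ 2 * (tauStar n η p μ S δ : ℝ) * fTilde η p δ := by gcongr
      _ = 207360 * (n : ℝ) ^ 2 * (fTilde η p δ * (tauStar n η p μ S δ : ℝ)) := by ring
      _ ≤ 207360 * (n : ℝ) ^ 2
          * (fTilde η p δ * min (1 + ratio n η p μ S δ ^ (1 / 3 : ℝ)) T) := by gcongr
      _ = _ := by ring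
  have hB0 := (frobSq_nonneg _).trans hbias
  unfold generalBound
  rw [mul_pow]
  set B := max (μ * dBar η p ^ 2 * n * (T : ℝ) ^ 2 * S
          / (1 + (ratio n η p μ S δ) ^ (2 / 3 : ℝ))) (μ * dBar η p ^ 2 * n * S)
        * (if tauStar n η p μ S δ < T then 1 else 0)
  set N := fTilde η p δ * (n : ℝ) ^ 2 * min (1 + ratio n η p μ S δ ^ (1 / 3 : ℝ)) T
  -- The factor `414720 = 2 * 207360` comes from the noise and dominates the factor `2 * 32` of the
  -- bias. Multiplying by `16` gives `6635520`.
  calc 16 / ((1 - η) ^ 2 * pMin p ^ 2)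
        * frobSq (gHat v (tauStar n η p μ S δ) (A ω) - dMat n η p * gBar g)
      ≤ 16 / ((1 - η) ^ 2 * pMin p ^ 2) * (414720 * (B + N)) := by
        gcongr
        linarith
    _ = _ := by ring

/-- For large `T` the general bound simplifies. -/
theorem generalBound_le_simpleBound (h : IsSetting P v η p g S μ A) {δ : ℝ}
    (hδ : 1 ≤ Real.log (1 / δ)) {C : ℝ} (hC : 0 ≤ C) (hS : 0 < S)
    (hT : LargeT 1 n η p μ S δ) :
    generalBound C n η p μ S δ ≤ simpleBound (3 * C) n η p μ S δ := by
  have hn : (0 : ℝ) < n := by exact_mod_cast Nat.pos_of_ne_zero (NeZero.ne n)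
  have hT0 : (0 : ℝ) < T := by exact_mod_cast Nat.pos_of_ne_zero (NeZero.ne T)
  have hη : 0 < 1 - η := by linarith [h.eta_lt_one]
  have hpm := pMin_pos h.p_pos
  have hμ : 0 < μ := zero_lt_one.trans_le h.mu_ge_one
  have hdb := dBar_pos h
  -- If `f̃ = 0` the quotients with denominator `n f̃` have only their default value, but `τ* = T`
  -- switches off the bias and both bounds are zero.
  rcases (fTilde_nonneg h hδ).eq_or_lt with h0 | hf
  · have hτ : tauStar n η p μ S δ = T := by rw [tauStar, if_pos h0.symm]
    unfold generalBound simpleBound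
    rw [hτ, ← h0, Real.zero_rpow (by norm_num)]
    simp
  · unfold LargeT at hT
    rw [one_mul] at hT
    have hb := bias_add_noise_le hf (mul_pos hμ (pow_pos hdb 2)) hn hT0 hS hT
    have hρ := ratio_nonneg h hδ
    have hM : (0 : ℝ) ≤ max (μ * dBar η p ^ 2 * n * (T : ℝ) ^ 2 * S
          / (1 + (ratio n η p μ S δ) ^ (2 / 3 : ℝ))) (μ * dBar η p ^ 2 * n * S) :=
      le_max_of_le_right (by positivity)
    unfold generalBound simpleBound
    calc _ ≤ C / ((1 - η) ^ 2 * pMin p ^ 2) *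
        (max (μ * dBar η p ^ 2 * n * (T : ℝ) ^ 2 * S / (1 + (ratio n η p μ S δ) ^ (2 / 3 : ℝ)))
          (μ * dBar η p ^ 2 * n * S)
          + fTilde η p δ * (n : ℝ) ^ 2 * (1 + (ratio n η p μ S δ) ^ (1 / 3 : ℝ))) := by
          gcongr
          · refine mul_le_of_le_one_right hM ?_
            split_ifs <;> norm_num
          · exact min_le_left _ _
      _ ≤ C / ((1 - η) ^ 2 * pMin p ^ 2) * (3 * (fTilde η p δ ^ (2 / 3 : ℝ)
          * (μ * dBar η p ^ 2) ^ (1 / 3 : ℝ) * (n : ℝ) ^ (5 / 3 : ℝ) * (T : ℝ) ^ (2 / 3 : ℝ)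
          * S ^ (1 / 3 : ℝ))) := by
          gcongr
          exact hb
      _ = _ := by ring

end Bounds

/-! ### The sparse regime -/

section Sparse

variable {n T : ℕ} [NeZero n] [NeZero T] {Ω : Type u} [MeasurableSpace Ω] {P : Measure Ω}
  {v : Fin T → Fin T → ℝ} {η : ℝ} {p : Fin T → ℝ} {g : Fin T → Fin n → ℂ} {S μ : ℝ}
  {A : Ω → Fin T → Matrix (Fin n) (Fin n) ℂ}

/-- Together with `le_fTilde` this pins `f̃` to the order of `log (1 / δ)` for fixed `η > 0`:
sparsity does not reduce `f̃` below that order, because `Q ≥ η`. -/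
theorem fTilde_le (h : IsSetting P v η p g S μ A) {δ : ℝ} (hδ : 1 ≤ Real.log (1 / δ)) :
    fTilde η p δ ≤ 12 * Real.log (1 / δ) := by
  have hp0 : ∀ k, 0 ≤ p k := fun k => (h.p_pos k).le
  have h1 := fNoise_le_three h.eta_nonneg h.eta_lt_one.le hp0 h.p_le_one
  have h2 := qNoise_le_three h.eta_nonneg h.eta_lt_one.le hp0 h.p_le_one
  have h3 : qNoise η p ^ 2 ≤ 3 ^ 2 := pow_le_pow_left₀ (h.eta_nonneg.trans le_qNoise) h2 2
  unfold fTilde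
  nlinarith

theorem mu_mul_dBar_sq_mem (h : IsSetting P v η p g S μ A) {a b m : ℝ} (ha : 0 < a)
    (hp : ∀ k, a / n ≤ p k ∧ p k ≤ b / n) (hμ : μ ≤ m) :
    (1 - η) ^ 2 * a ^ 2 / (n : ℝ) ^ 2 ≤ μ * dBar η p ^ 2 ∧
      μ * dBar η p ^ 2 ≤ m * (1 - η) ^ 2 * b ^ 2 / (n : ℝ) ^ 2 := by
  have hn : (0 : ℝ) < n := by exact_mod_cast Nat.pos_of_ne_zero (NeZero.ne n)
  have hη : 0 < 1 - η := by linarith [h.eta_lt_one]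
  have h1 : (1 - η) * (a / n) ≤ dBar η p :=
    le_dBar fun k => mul_le_mul_of_nonneg_left (hp k).1 hη.le
  have h2 : dBar η p ≤ (1 - η) * (b / n) :=
    dBar_le fun k => mul_le_mul_of_nonneg_left (hp k).2 hη.le
  have hd := dBar_pos h
  have hμ1 := h.mu_ge_one
  constructor
  · calc (1 - η) ^ 2 * a ^ 2 / (n : ℝ) ^ 2 = 1 * ((1 - η) * (a / n)) ^ 2 := by ring
      _ ≤ _ := by gcongr
  · calc μ * dBar η p ^ 2 ≤ m * ((1 - η) * (b / n)) ^ 2 := by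
          have : 0 ≤ m := by linarith
          gcongr
      _ = _ := by ring

/-- In the sparse regime `T` is large as soon as it is large in terms of `n`, `S` and `δ`. -/
theorem largeT_of_sparse (h : IsSetting P v η p g S μ A) {a b m : ℝ} (hη0 : 0 < η) (ha : 0 < a)
    (hp : ∀ k, a / n ≤ p k ∧ p k ≤ b / n) (hμ : μ ≤ m) (hS : 0 < S) {δ : ℝ}
    (hδ : 1 ≤ Real.log (1 / δ)) {K : ℝ} (hK1 : (12 / ((1 - η) ^ 2 * a ^ 2)) ^ (1 / 2 : ℝ) ≤ K)
    (hK2 : m * (1 - η) ^ 2 * b ^ 2 / η ^ 2 ≤ K)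
    (hT : K * max (((n : ℝ) ^ 3 * Real.log (1 / δ) / S) ^ (1 / 2 : ℝ))
      (S / ((n : ℝ) ^ 3 * Real.log (1 / δ))) ≤ T) :
    LargeT 1 n η p μ S δ := by
  have hn : (0 : ℝ) < n := by exact_mod_cast Nat.pos_of_ne_zero (NeZero.ne n)
  have hη : 0 < 1 - η := by linarith [h.eta_lt_one]
  obtain ⟨hd1, hd2⟩ := mu_mul_dBar_sq_mem h ha hp hμ
  have hf1 := le_fTilde h hδ
  have hf2 := fTilde_le h hδ
  have hf0 := fTilde_nonneg h hδ
  have hM : 0 < μ * dBar η p ^ 2 := lt_of_lt_of_le (by positivity) hd1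
  set ℓ := Real.log (1 / δ)
  have hℓ : 0 < ℓ := by linarith
  have hK0 : 0 ≤ K := le_trans (by positivity) hK1
  have hm : 0 ≤ m := by linarith [h.mu_ge_one]
  unfold LargeT
  rw [one_mul]
  refine max_le ?_ ?_
  · calc (n * fTilde η p δ / (μ * dBar η p ^ 2 * S)) ^ (1 / 2 : ℝ)
        ≤ (n * (12 * ℓ) / ((1 - η) ^ 2 * a ^ 2 / (n : ℝ) ^ 2 * S)) ^ (1 / 2 : ℝ) := by gcongr
      _ = (12 / ((1 - η) ^ 2 * a ^ 2) * ((n : ℝ) ^ 3 * ℓ / S)) ^ (1 / 2 : ℝ) := by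
          congr 1
          field_simp
      _ = (12 / ((1 - η) ^ 2 * a ^ 2)) ^ (1 / 2 : ℝ) * ((n : ℝ) ^ 3 * ℓ / S) ^ (1 / 2 : ℝ) :=
          Real.mul_rpow (by positivity) (by positivity)
      _ ≤ K * max (((n : ℝ) ^ 3 * ℓ / S) ^ (1 / 2 : ℝ)) (S / ((n : ℝ) ^ 3 * ℓ)) := by
          gcongr
          exact le_max_left _ _
      _ ≤ T := hT
  · calc μ * dBar η p ^ 2 * S / (n * fTilde η p δ)
        ≤ m * (1 - η) ^ 2 * b ^ 2 / (n : ℝ) ^ 2 * S / (n * (η ^ 2 * ℓ)) := by gcongr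
      _ = m * (1 - η) ^ 2 * b ^ 2 / η ^ 2 * (S / ((n : ℝ) ^ 3 * ℓ)) := by
          field_simp
      _ ≤ K * max (((n : ℝ) ^ 3 * ℓ / S) ^ (1 / 2 : ℝ)) (S / ((n : ℝ) ^ 3 * ℓ)) := by
          gcongr
          exact le_max_right _ _
      _ ≤ T := hT

theorem simpleBound_le_of_sparse (h : IsSetting P v η p g S μ A) {a b m : ℝ} (ha : 0 < a)
    (hp : ∀ k, a / n ≤ p k ∧ p k ≤ b / n) (hμ : μ ≤ m) {δ : ℝ}
    (hδ : 1 ≤ Real.log (1 / δ)) {C : ℝ} (hC : 0 ≤ C) :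
    simpleBound C n η p μ S δ ≤
      C * 12 ^ (2 / 3 : ℝ) / ((1 - η) ^ 2 * a ^ 2) * (m * (1 - η) ^ 2 * b ^ 2) ^ (1 / 3 : ℝ)
        * (n : ℝ) ^ 3 * (T : ℝ) ^ (2 / 3 : ℝ) * S ^ (1 / 3 : ℝ)
        * Real.log (1 / δ) ^ (2 / 3 : ℝ) := by
  have hn : (0 : ℝ) < n := by exact_mod_cast Nat.pos_of_ne_zero (NeZero.ne n)
  have hη : 0 < 1 - η := by linarith [h.eta_lt_one]
  obtain ⟨hd1, hd2⟩ := mu_mul_dBar_sq_mem h ha hp hμ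
  have hf2 := fTilde_le h hδ
  have hf0 := fTilde_nonneg h hδ
  have hpm : a / n ≤ pMin p := le_pMin fun k => (hp k).1
  have hpm0 := pMin_pos h.p_pos
  have hM : 0 < μ * dBar η p ^ 2 := lt_of_lt_of_le (by positivity) hd1
  have hS := h.S_nonneg
  set ℓ := Real.log (1 / δ)
  have hℓ : 0 < ℓ := by linarith
  have hm : 0 ≤ m := by linarith [h.mu_ge_one]
  -- Bookkeeping of powers of `n`: `n²` from `p_min`, `n^(-2/3)` from the cube root of `μ d̄²` and
  -- `n^(5/3)` combine to `n³`.
  have hn53 : (n : ℝ) ^ (5 / 3 : ℝ) = n * ((n : ℝ) ^ 2) ^ (1 / 3 : ℝ) := by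
    rw [← Real.rpow_natCast, ← Real.rpow_mul hn.le]
    nth_rewrite 2 [← Real.rpow_one (n : ℝ)]
    rw [← Real.rpow_add hn]
    norm_num
  unfold simpleBound
  calc _ ≤ C * ((12 * ℓ) ^ (2 / 3 : ℝ) / ((1 - η) ^ 2 * (a / n) ^ 2))
        * (m * (1 - η) ^ 2 * b ^ 2 / (n : ℝ) ^ 2) ^ (1 / 3 : ℝ) * (n : ℝ) ^ (5 / 3 : ℝ)
        * (T : ℝ) ^ (2 / 3 : ℝ) * S ^ (1 / 3 : ℝ) := by gcongr
    _ = _ := by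
        rw [Real.mul_rpow (by norm_num) hℓ.le, Real.div_rpow (by positivity) (by positivity), hn53]
        have : ((n : ℝ) ^ 2) ^ (1 / 3 : ℝ) ≠ 0 := by positivity
        field_simp

end Sparse

end DynSync

/-! ### Choice of the constants and assembly. -/

theorem one_le_log_one_div {δ : ℝ} (h0 : 0 < δ) (h1 : δ < Real.exp (-1)) :
    1 ≤ Real.log (1 / δ) := by
  have := Real.log_lt_log h0 h1
  rw [Real.log_exp] at this
  rw [one_div, Real.log_inv]
  linarith

theorem mainTheorem5 :
    ∃ C₁ C₂ C₃ C₄ : ℝ, 0 < C₁ ∧ C₁ < 1 ∧ 0 < C₂ ∧ 0 < C₃ ∧ 0 < C₄ ∧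
      -- the general bound, and the simplified bound that it implies for large `T`
      (∀ (n T : ℕ) [NeZero n] [NeZero T] (Ω : Type u) [MeasurableSpace Ω] (P : Measure Ω)
          (v : Fin T → Fin T → ℝ) (η : ℝ) (p : Fin T → ℝ) (g : Fin T → Fin n → ℂ) (S μ : ℝ)
          (A : Ω → Fin T → Matrix (Fin n) (Fin n) ℂ),
          DynSync.IsSetting P v η p g S μ A →
          ∀ δ : ℝ, 0 < δ → δ < C₁ →
            DynSync.WithProbAtLeast P (1 - δ) (fun ω =>
              ∀ gh : Fin T → Fin n → ℂ,
                DynSync.IsOutput v (DynSync.tauStar n η p μ S δ) (A ω) gh →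
                  DynSync.distSq gh g ≤ DynSync.generalBound C₂ n η p μ S δ ∧
                  (0 < S → DynSync.LargeT C₃ n η p μ S δ →
                    DynSync.distSq gh g ≤ DynSync.simpleBound C₄ n η p μ S δ)) ∧
            (0 < S → DynSync.LargeT C₃ n η p μ S δ →
              DynSync.generalBound C₂ n η p μ S δ ≤ DynSync.simpleBound C₄ n η p μ S δ)) ∧
      -- the sparse regime, where all connection probabilities are of order `1 / n`
      (∀ η a b m : ℝ, 0 < η → η < 1 → 0 < a → 0 < b → 1 ≤ m →
        ∃ K₁ K₂ : ℝ, 0 < K₁ ∧ 0 < K₂ ∧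
          ∀ (n T : ℕ) [NeZero n] [NeZero T] (Ω : Type u) [MeasurableSpace Ω] (P : Measure Ω)
            (v : Fin T → Fin T → ℝ) (p : Fin T → ℝ) (g : Fin T → Fin n → ℂ) (S μ : ℝ)
            (A : Ω → Fin T → Matrix (Fin n) (Fin n) ℂ),
            DynSync.IsSetting P v η p g S μ A →
            (∀ k, a / n ≤ p k ∧ p k ≤ b / n) → μ ≤ m → 0 < S →
            ∀ δ : ℝ, 0 < δ → δ < C₁ →
              K₁ * max (((n : ℝ) ^ 3 * Real.log (1 / δ) / S) ^ (1 / 2 : ℝ))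
                (S / ((n : ℝ) ^ 3 * Real.log (1 / δ))) ≤ T →
              DynSync.WithProbAtLeast P (1 - δ) (fun ω =>
                ∀ gh : Fin T → Fin n → ℂ,
                  DynSync.IsOutput v (DynSync.tauStar n η p μ S δ) (A ω) gh →
                    DynSync.distSq gh g ≤
                      K₂ * (n : ℝ) ^ 3 * (T : ℝ) ^ (2 / 3 : ℝ) * S ^ (1 / 3 : ℝ) *
                        Real.log (1 / δ) ^ (2 / 3 : ℝ))) := by

  -- The threshold `exp (-1)` for `δ` guarantees `log (1 / δ) ≥ 1`, which is assumed throughout. The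
  -- factor `3` in the last constant is the loss in `bias_add_noise_le`.
  refine ⟨Real.exp (-1), 6635520, 1, 3 * 6635520, Real.exp_pos _,
    (Real.exp_lt_exp.mpr (by norm_num : (-1 : ℝ) < 0)).trans_eq Real.exp_zero,
    by norm_num, by norm_num, by norm_num, ?_, ?_⟩
  · intro n T _ _ Ω _ P v η p g S μ A h δ hδ0 hδ1
    have hδ := one_le_log_one_div hδ0 hδ1
    have hle : 0 < S → DynSync.LargeT 1 n η p μ S δ →
        DynSync.generalBound 6635520 n η p μ S δ ≤
          DynSync.simpleBound (3 * 6635520) n η p μ S δ :=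
      fun hS hT => DynSync.generalBound_le_simpleBound h hδ (by norm_num) hS hT
    refine ⟨?_, hle⟩
    obtain ⟨E, hE, hPE, hgood⟩ := DynSync.withProbAtLeast_distSq_le h hδ0 hδ
    exact ⟨E, hE, hPE, fun ω hω gh hgh =>
      ⟨hgood ω hω gh hgh, fun hS hT => (hgood ω hω gh hgh).trans (hle hS hT)⟩⟩
  · intro η a b m hη0 hη1 ha hb hm
    have hη : 0 < 1 - η := by linarith
    -- `K₁` is the larger of the ratios between the two sparse thresholds and the general ones; its
    -- second argument uses the lower bound `η² log (1 / δ)` on `f̃`, hence the need for `η > 0`.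
    refine ⟨max ((12 / ((1 - η) ^ 2 * a ^ 2)) ^ (1 / 2 : ℝ)) (m * (1 - η) ^ 2 * b ^ 2 / η ^ 2),
      3 * 6635520 * 12 ^ (2 / 3 : ℝ) / ((1 - η) ^ 2 * a ^ 2)
        * (m * (1 - η) ^ 2 * b ^ 2) ^ (1 / 3 : ℝ),
      lt_max_of_lt_left (by positivity), by positivity, ?_⟩
    intro n T _ _ Ω _ P v p g S μ A h hp hμ hS δ hδ0 hδ1 hT
    have hδ := one_le_log_one_div hδ0 hδ1
    have hL := DynSync.largeT_of_sparse h hη0 ha hp hμ hS hδ (le_max_left _ _) (le_max_right _ _) hT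
    obtain ⟨E, hE, hPE, hgood⟩ := DynSync.withProbAtLeast_distSq_le h hδ0 hδ
    exact ⟨E, hE, hPE, fun ω hω gh hgh => (hgood ω hω gh hgh).trans
      ((DynSync.generalBound_le_simpleBound h hδ (by norm_num) hS hL).trans
        (DynSync.simpleBound_le_of_sparse h ha hp hμ hδ (by norm_num)))⟩
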